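/- Let $\omega,\mu,\gamma,\mu_0,\varepsilon_0>0$ be real constants, let $\Omega\subset\mathbb R^3$ be an open set (for instance a bounded Lipschitz domain with connected complement) and let $\Gamma\subset\partial\Omega$ be relatively open in $\partial\Omega$ with $\mathbf 0\in\Gamma$. For an open set $D$ let $H(\mathrm{curl},D)$ be the space of $\mathbf U\in L^2(D)^3$ with distributional curl $\nabla\wedge\mathbf U\in L^2(D)^3$, with norm $(\|\mathbf U\|_{L^2(D)}^2+\|\nabla\wedge\mathbf U\|_{L^2(D)}^2)^{1/2}$. Let $\mathbf E^t,\mathbf H^t,\mathbf E^0,\mathbf H^0\in H(\mathrm{curl},\Omega)$, not all zero, satisfy $$\nabla\wedge\mathbf E^t-\mathrm i\omega\mu\mathbf H^t=\mathbf 0,\quad \nabla\wedge\mathbf H^t+\mathrm i\omega\gamma\mathbf E^t=\mathbf 0,\quad \nabla\wedge\mathbf E^0-\mathrm i\omega\mu_0\mathbf H^0=\mathbf 0,\quad \nabla\wedge\mathbf H^0+\mathrm i\omega\varepsilon_0\mathbf E^0=\mathbf 0\quad\text{in }\Omega,$$ $$\nu\times\mathbf E^t=\nu\times\mathbf E^0,\qquad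 \nu\times\mathbf H^t=\nu\times\mathbf H^0\quad\text{on }\Gamma,$$ where the equations hold in the sense of distributions, and $\nu\times\mathbf U=\nu\times\mathbf U'$ on $\Gamma$ means that $$\int_\Omega\big((\nabla\wedge\mathbf U)\cdot\boldsymbol\varphi-\mathbf U\cdot(\nabla\wedge\boldsymbol\varphi)\big)\,\mathrm d\mathbf x=\int_\Omega\big((\nabla\wedge\mathbf U')\cdot\boldsymbol\varphi-\mathbf U'\cdot(\nabla\wedge\boldsymbol\varphi)\big)\,\mathrm d\mathbf x$$ for all $\boldsymbol\varphi\in C_c^\infty(\mathbb R^3;\mathbb C^3)$ whose support does not meet $\partial\Omega\setminus\Gamma$. (That is, $\mathbf E^t,\mathbf H^t,\mathbf E^0,\mathbf H^0$ are transmission eigenfunctions for the eigenvalue $\omega$.) Suppose that $\Omega$ has a conical corner at $\mathbf 0$: there are $r_0>0$, $\theta_0\in(0,\pi/2)$ and a unit vector $\mathbf a$ such that $\Omega\cap B(\mathbf 0,r_0)=\mathcal K_{r_0}$, where $\mathcal K_{r_0}$ is the set of all $\mathbf x\neq\mathbf 0$ with $|\mathbf x|<r_0$ whose angle with $\mathbf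 a$ is less than $\theta_0$. Put $k_1=\omega\sqrt{\mu\gamma}$, and for $\mathbf g\in L^2(\mathbb S^2;\mathbb C^3)$ let $\mathbf E_{\mathbf g}(\mathbf x)=\int_{\mathbb S^2}\mathbf g(\mathbf d)\,e^{\mathrm ik_1\mathbf x\cdot\mathbf d}\,\mathrm d\sigma(\mathbf d)$ be the Herglotz wave with kernel $\mathbf g$. Suppose that there are real numbers $\zeta,\beta,\zeta',\beta'>0$ with $\beta<\frac23\zeta$ and $\beta'<\frac23\zeta'$, and kernels $\mathbf g_j,\mathbf f_j\in L^2(\mathbb S^2;\mathbb C^3)$, $j=1,2,\dots$, such that for all $j\ge1$ $$\|\mathbf E^t-\mathbf E_{\mathbf g_j}\|_{H(\mathrm{curl},\mathcal K_{r_0})}\le j^{-\zeta},\quad \|\mathbf g_j\|_{L^2(\mathbb S^2)}\le j^{\beta},\qquad \|\mathbf H^t-\mathbf E_{\mathbf f_j}\|_{H(\mathrm{curl},\mathcal K_{r_0})}\le j^{-\zeta'},\quad \|\mathbf f_j\|_{L^2(\mathbb S^2)}\le j^{\beta'}.$$ Then, with $m$ the Lebesgue measure, $$\gamma\neq\varepsilon_0\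 \Longrightarrow\ \lim_{\rho\to+0}\frac1{m(B(\mathbf 0,\rho)\cap\mathcal K_{r_0})}\int_{B(\mathbf 0,\rho)\cap\mathcal K_{r_0}}|\mathbf E^t(\mathbf x)|\,\mathrm d\mathbf x=0,$$ $$\mu\neq\mu_0\ \Longrightarrow\ \lim_{\rho\to+0}\frac1{m(B(\mathbf 0,\rho)\cap\mathcal K_{r_0})}\int_{B(\mathbf 0,\rho)\cap\mathcal K_{r_0}}|\mathbf H^t(\mathbf x)|\,\mathrm d\mathbf x=0.$$ -/

import Mathlib

noncomputable section

namespace ConicalMaxwell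

open MeasureTheory

/-- Physical space `ℝ³` with the Euclidean norm. -/
abbrev R3 : Type := EuclideanSpace ℝ (Fin 3)

/-- The space `ℂ³` of field values, with the Hermitian norm. -/
abbrev C3 : Type := EuclideanSpace ℂ (Fin 3)

/-- The unit sphere `𝕊²`. -/
abbrev S2 : Type := Metric.sphere (0 : R3) 1

/-- The surface measure on `𝕊²`. -/
def sphereMeasure : Measure S2 := (volume : Measure R3).toSphere

/-- The bilinear dot product `u · v = ∑ uᵢ vᵢ` on `ℂ³` (no complex conjugation). -/
def cdot (u v : C3) : ℂ := ∑ i, u i * v i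

/-- The partial derivative `∂ᵢ φₖ (x)`. -/
def partialDeriv (i k : Fin 3) (φ : R3 → C3) (x : R3) : ℂ :=
  (fderiv ℝ φ x (EuclideanSpace.single i 1)) k

/-- The classical curl `∇ ∧ φ` of a differentiable vector field. -/
def curl (φ : R3 → C3) (x : R3) : C3 :=
  !₂[partialDeriv 1 2 φ x - partialDeriv 2 1 φ x,
     partialDeriv 2 0 φ x - partialDeriv 0 2 φ x,
     partialDeriv 0 1 φ x - partialDeriv 1 0 φ x]

/-- `C = ∇ ∧ U` in the open set `D` in the sense of distributions. -/
structure HasWeakCurl (U C : R3 → C3) (D : Set R3) : Prop where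
  locallyIntegrable : LocallyIntegrableOn U D volume
  locallyIntegrable_curl : LocallyIntegrableOn C D volume
  integral_eq : ∀ φ : R3 → C3, ContDiff ℝ (⊤ : ℕ∞) φ → HasCompactSupport φ → tsupport φ ⊆ D →
    ∫ x in D, cdot (C x) (φ x) = ∫ x in D, cdot (U x) (curl φ x)

/-- `U ∈ H(curl, D)`: both `U` and its distributional curl are square integrable on `D`. -/
def MemHcurl (U : R3 → C3) (D : Set R3) : Prop :=
  MemLp U 2 (volume.restrict D) ∧
    ∃ C : R3 → C3, MemLp C 2 (volume.restrict D) ∧ HasWeakCurl U C D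

/-- The `H(curl, D)` norm `(‖U‖²_{L²(D)} + ‖∇ ∧ U‖²_{L²(D)})^{1/2}`, with values in `[0, ∞]`.
The distributional curl is unique almost everywhere when it exists, so that the infimum is over
at most one value; it is `∞` if there is no locally integrable distributional curl. -/
def hcurlNorm (U : R3 → C3) (D : Set R3) : ENNReal :=
  ⨅ (C : R3 → C3) (_ : HasWeakCurl U C D),
    (eLpNorm U 2 (volume.restrict D) ^ 2 + eLpNorm C 2 (volume.restrict D) ^ 2) ^ (1 / 2 : ℝ)

/-- `ν × U = ν × U'` on the relatively open part `Γ` of `∂Ω`, for `U, U' ∈ H(curl, Ω)`: the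
tangential trace of `U` is the functional
`⟨ν × U, φ⟩ = ∫_Ω (∇ ∧ U) · φ - U · (∇ ∧ φ)`, and the two traces agree on all smooth compactly
supported `φ` that vanish near `∂Ω \ Γ`.  The quantified `C`, `C'` are the curls of `U` and `U'`,
which exist and are unique almost everywhere. -/
def TangentialTraceEqOn (Ω Γ : Set R3) (U U' : R3 → C3) : Prop :=
  ∀ C C' : R3 → C3, HasWeakCurl U C Ω → HasWeakCurl U' C' Ω →
    ∀ φ : R3 → C3, ContDiff ℝ (⊤ : ℕ∞) φ → HasCompactSupport φ →
      Disjoint (tsupport φ) (frontier Ω \ Γ) →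
      ∫ x in Ω, (cdot (C x) (φ x) - cdot (U x) (curl φ x)) =
        ∫ x in Ω, (cdot (C' x) (φ x) - cdot (U' x) (curl φ x))

/-- `(Et, Ht)`, `(E0, H0)` is a pair of (full- or partial-data) electromagnetic transmission
eigenfunctions in `Ω` at the frequency `ω`, with constant parameters `μ, γ` and background
parameters `μ0, ε0`; the transmission conditions hold on `Γ`. -/
structure IsTransmissionEigenpair (Ω Γ : Set R3) (ω μ γ μ0 ε0 : ℝ)
    (Et Ht E0 H0 : R3 → C3) : Prop where
  memHcurl_Et : MemHcurl Et Ω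
  memHcurl_Ht : MemHcurl Ht Ω
  memHcurl_E0 : MemHcurl E0 Ω
  memHcurl_H0 : MemHcurl H0 Ω
  curl_Et : HasWeakCurl Et (fun x => (Complex.I * ω * μ) • Ht x) Ω
  curl_Ht : HasWeakCurl Ht (fun x => (-(Complex.I * ω * γ)) • Et x) Ω
  curl_E0 : HasWeakCurl E0 (fun x => (Complex.I * ω * μ0) • H0 x) Ω
  curl_H0 : HasWeakCurl H0 (fun x => (-(Complex.I * ω * ε0)) • E0 x) Ω
  trace_E : TangentialTraceEqOn Ω Γ Et E0
  trace_H : TangentialTraceEqOn Ω Γ Ht H0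
  nontrivial : ¬ ((∀ᵐ x ∂(volume.restrict Ω), Et x = 0) ∧
    (∀ᵐ x ∂(volume.restrict Ω), Ht x = 0) ∧ (∀ᵐ x ∂(volume.restrict Ω), E0 x = 0) ∧
    (∀ᵐ x ∂(volume.restrict Ω), H0 x = 0))

/-- The open circular cone with apex `0`, axis `a` and opening angle `2 * θ0`.  The apex is not
in it when `θ0 ≤ π / 2`, as the angle between `0` and `a` is `π / 2` by convention. -/
def cone (a : R3) (θ0 : ℝ) : Set R3 := {x | InnerProductGeometry.angle x a < θ0}

/-- The truncated cone `K_{r0} = K ∩ B_{r0}(0)`. -/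
def truncCone (a : R3) (θ0 r0 : ℝ) : Set R3 := cone a θ0 ∩ Metric.ball 0 r0

/-- The Herglotz wave with kernel `g` and wavenumber `k`:
`x ↦ ∫_{𝕊²} g(d) exp(i k x · d) dσ(d)`. -/
def herglotz (k : ℝ) (g : S2 → C3) (x : R3) : C3 :=
  ∫ d : S2, Complex.exp (Complex.I * k * (inner ℝ x (d : R3) : ℝ)) • g d ∂sphereMeasure

end ConicalMaxwell

end

noncomputable section

namespace ConicalMaxwell

open MeasureTheory Set Filter Topology

/-! Near the apex the trace conditions turn the difference of the two Maxwell systems into weak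
identities on the truncated cone `K`, valid for test fields that need not vanish on the lateral
boundary. They are tested with `χ e P` and `χ e Q`. Here `χ` is a cutoff, `e = exp(-(τ a + i σ b) ·
x)` with `b ⊥ a` and `σ² = τ² + ω² ε0 μ0`, and `(e P, e Q)` solves the background Maxwell system.
The background fields then survive only in terms containing `grad χ`, which are exponentially small
in `τ`. What remains (`cutoff_cgo_identity`) is `(γ - ε0) ∫ E · χ e P = (μ - μ0) ∫ H · χ e Q` up to
these terms, with `P = O(1)` and `Q = O(1/τ)`.

On the cone `|e| ≤ exp(-τ cos θ0 |x|)`, so `τ ^ 3` is the natural normalization. A Herglotz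
approximation of `E` or `H` is chosen with index a power of `τ`; the condition `β < 2 ζ / 3` is what
lets the `L²` error be `o(τ^(-3/2))` while the sup norm and the Lipschitz constant are `o(τ)`
(`exists_isScaleApprox`). Hence the magnetic term is `o(τ^(-3))`, and `E` may be replaced by the
value `G τ 0` of its approximation at the apex. Since `τ ^ 3 ∫ χ e` tends to the integral of
`exp(-(a + i b) · x)` over the infinite cone, which is nonzero (`integral_cone_cexp_ne_zero`), `G τ
0 · P → 0`. Varying `b` gives `G τ 0 → 0` (`tendsto_zero_of_cdot_elecPol`), and the choice `τ = 1 /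
ρ` carries this over to the averages of `|E|` on balls of radius `ρ`
(`IsScaleApprox.tendsto_average`).

The magnetic claim is the electric one for the dual fields `(H, -E)`, with permittivities and
permeabilities exchanged. -/

/-! ### Nonvanishing of the exponential integral over the infinite cone. -/

theorem exists_measurableEquiv_coords {a b : R3} (ha : ‖a‖ = 1) (hb : ‖b‖ = 1)
    (hab : inner ℝ a b = 0) :
    ∃ Ψ : R3 ≃ᵐ ℝ × ℝ × ℝ, MeasurePreserving Ψ volume volume ∧
      (∀ x, (Ψ x).1 = inner ℝ a x) ∧ (∀ x, (Ψ x).2.1 = inner ℝ b x) ∧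
      ∀ x, ‖x‖ ^ 2 = (Ψ x).1 ^ 2 + ((Ψ x).2.1 ^ 2 + (Ψ x).2.2 ^ 2) := by
  have hon : Orthonormal ℝ (({0, 1} : Set (Fin 3)).domRestrict ![a, b, 0]) := by
    rw [orthonormal_iff_ite]
    rintro ⟨i, hi⟩ ⟨j, hj⟩
    simp only [mem_insert_iff, mem_singleton_iff] at hi hj
    rcases hi with rfl | rfl <;> rcases hj with rfl | rfl <;>
      simp [domRestrict, ha, hb, hab, real_inner_comm a b]
  obtain ⟨B, hB⟩ := hon.exists_orthonormalBasis_extension_of_card_eq (by simp)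
  have hB0 : B 0 = a := by simpa using hB 0 (by simp)
  have hB1 : B 1 = b := by simpa using hB 1 (by simp)
  let e1 : R3 ≃ᵐ R3 := B.repr.toHomeomorph.toMeasurableEquiv
  let e2 : R3 ≃ᵐ (Fin 3 → ℝ) := (MeasurableEquiv.toLp 2 (Fin 3 → ℝ)).symm
  let e3 := MeasurableEquiv.piFinSuccAbove (fun _ : Fin 3 => ℝ) 0
  let e4 : ℝ × (Fin 2 → ℝ) ≃ᵐ ℝ × ℝ × ℝ :=
    (MeasurableEquiv.refl ℝ).prodCongr MeasurableEquiv.finTwoArrow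
  refine ⟨((e1.trans e2).trans e3).trans e4, ?_, ?_, ?_, ?_⟩
  · have h1 : MeasurePreserving e1 volume volume := B.measurePreserving_repr
    have h2 : MeasurePreserving e2 volume volume :=
      EuclideanSpace.volume_preserving_symm_measurableEquiv_toLp (Fin 3)
    have h3 : MeasurePreserving e3 volume volume :=
      volume_preserving_piFinSuccAbove (fun _ : Fin 3 => ℝ) 0
    have h4 : MeasurePreserving e4 volume volume :=
      (MeasurePreserving.id volume).prod (volume_preserving_finTwoArrow ℝ)
    exact h4.comp (h3.comp (h2.comp h1))
  · intro x
    rw [← hB0, ← B.repr_apply_apply]; rfl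
  · intro x
    rw [← hB1, ← B.repr_apply_apply]; rfl
  · intro x
    rw [← B.repr.norm_map x, EuclideanSpace.norm_sq_eq, Fin.sum_univ_three]
    simp only [Real.norm_eq_abs, sq_abs, add_assoc]
    rfl

theorem integrableOn_mul_exp_neg_mul_Ioi {A : ℝ} (hA : 0 < A) :
    IntegrableOn (fun r : ℝ => r * Real.exp (-(A * r))) (Ioi 0) := by
  have := integrableOn_rpow_mul_exp_neg_mul_rpow (s := 1) (p := 1) (by norm_num) one_pos hA
  refine this.congr_fun (fun r _ => ?_) measurableSet_Ioi
  simp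

theorem norm_cexp_neg_mul_ofReal (z : ℂ) (r : ℝ) :
    ‖Complex.exp (-(z * r))‖ = Real.exp (-(z.re * r)) := by
  rw [Complex.norm_exp]; simp

theorem integral_mul_cexp_neg_mul_Ioi {z : ℂ} (hz : 0 < z.re) :
    ∫ r in Ioi (0 : ℝ), (r : ℂ) * Complex.exp (-(z * r)) = 1 / z ^ 2 := by
  have hz0 : z ≠ 0 := fun h => by simp [h] at hz
  have hderiv : ∀ r : ℝ, HasDerivAt (fun r : ℝ => -((r : ℂ) / z + 1 / z ^ 2) *
      Complex.exp (-(z * r))) ((r : ℂ) * Complex.exp (-(z * r))) r := fun r => by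
    have h1 : HasDerivAt (fun r : ℝ => (r : ℂ)) 1 r := Complex.ofRealCLM.hasDerivAt
    have h2 := ((h1.div_const z).add_const (1 / z ^ 2)).neg.mul ((h1.const_mul z).neg.cexp)
    refine h2.congr_deriv ?_
    change -(1 / z) * Complex.exp (-(z * r)) + -((r : ℂ) / z + 1 / z ^ 2) *
      (Complex.exp (-(z * r)) * -(z * 1)) = _
    field_simp
    ring
  have hint : IntegrableOn (fun r : ℝ => (r : ℂ) * Complex.exp (-(z * r))) (Ioi 0) := by
    refine (integrableOn_mul_exp_neg_mul_Ioi hz).mono'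
      (Continuous.aestronglyMeasurable (by fun_prop)) ?_
    filter_upwards [ae_restrict_mem measurableSet_Ioi] with r hr
    rw [norm_mul, norm_cexp_neg_mul_ofReal, Complex.norm_real, Real.norm_of_nonneg (le_of_lt hr)]
  have hlim : Tendsto (fun r : ℝ => -((r : ℂ) / z + 1 / z ^ 2) * Complex.exp (-(z * r))) atTop
      (𝓝 0) := by
    have hr : Tendsto (fun r : ℝ => z.re * r) atTop atTop := tendsto_id.const_mul_atTop hz
    have h1 := ((Real.tendsto_pow_mul_exp_neg_atTop_nhds_zero 1).comp hr).const_mul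
      (‖z‖⁻¹ * z.re⁻¹)
    have h0 := ((Real.tendsto_pow_mul_exp_neg_atTop_nhds_zero 0).comp hr).const_mul (‖1 / z ^ 2‖)
    have h2 := h1.add h0
    simp only [mul_zero, add_zero] at h2
    refine squeeze_zero_norm' ?_ h2
    filter_upwards [eventually_ge_atTop 0] with r hr
    rw [norm_mul, norm_cexp_neg_mul_ofReal, norm_neg]
    have : ‖(r : ℂ) / z + 1 / z ^ 2‖ ≤ ‖z‖⁻¹ * r + ‖1 / z ^ 2‖ := by
      refine (norm_add_le _ _).trans (add_le_add_left (le_of_eq ?_) _)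
      rw [norm_div, Complex.norm_real, Real.norm_of_nonneg hr, div_eq_inv_mul]
    refine (mul_le_mul_of_nonneg_right this (Real.exp_pos _).le).trans (le_of_eq ?_)
    simp only [Function.comp_apply, pow_one, pow_zero, one_mul]
    field_simp
  rw [integral_Ioi_of_hasDerivAt_of_tendsto (hderiv 0).continuousAt.continuousWithinAt
    (fun r _ => hderiv r) hint hlim]
  simp

/-- The angular integral `∫ (A + i cos φ)⁻² dφ` has positive real part. -/
theorem integral_inv_sq_add_I_mul_cos_ne_zero {A : ℝ} (hA : 0 < A) :
    ∫ t in Ioo (-Real.pi) Real.pi, 1 / ((A : ℂ) + Complex.I * Real.cos t) ^ 2 ≠ 0 := by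
  have hne : ∀ t : ℝ, ((A : ℂ) + Complex.I * Real.cos t) ≠ 0 := fun t h => by
    have := congrArg Complex.re h
    simp at this
    exact hA.ne' this
  have hpos : ∀ t : ℝ, 0 < A ^ 2 + Real.cos t ^ 2 := fun t => by positivity
  have hcont : Continuous fun t : ℝ => 1 / ((A : ℂ) + Complex.I * Real.cos t) ^ 2 := by
    refine continuous_const.div (by fun_prop) fun t => pow_ne_zero _ (hne t)
  have hc1 : Continuous fun t : ℝ => 1 / (A ^ 2 + Real.cos t ^ 2) :=
    continuous_const.div (by fun_prop) fun t => (hpos t).ne'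
  have hc2 : Continuous fun t : ℝ => (2 * Real.cos t ^ 2 * A ^ 2 - A ^ 2 + Real.cos t ^ 2) /
      (A ^ 2 + Real.cos t ^ 2) ^ 2 :=
    Continuous.div (by fun_prop) (by fun_prop) fun t => pow_ne_zero _ (hpos t).ne'
  have hpi : -Real.pi ≤ Real.pi := by linarith [Real.pi_pos]
  -- The real part `(A² - cos²) / (A² + cos²)²` changes sign when `A < 1`. It is split into a
  -- positive function and a multiple of the derivative of `sin cos / (A² + cos²)`, which integrates
  -- to zero over a period.
  have hre : ∀ t : ℝ, (1 / ((A : ℂ) + Complex.I * Real.cos t) ^ 2).re =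
      A ^ 2 / (A ^ 2 + 1) * (1 / (A ^ 2 + Real.cos t ^ 2)) - 1 / (A ^ 2 + 1) *
        ((2 * Real.cos t ^ 2 * A ^ 2 - A ^ 2 + Real.cos t ^ 2) /
          (A ^ 2 + Real.cos t ^ 2) ^ 2) := fun t => by
    have h1 := (hpos t).ne'
    have h2 : Complex.normSq ((A + Complex.I * Real.cos t) ^ 2) = (A ^ 2 + Real.cos t ^ 2) ^ 2 := by
      rw [map_pow]
      congr 1
      simp only [Complex.normSq_apply, Complex.add_re, Complex.mul_re, Complex.I_re, Complex.I_im,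
        Complex.ofReal_re, Complex.ofReal_im, Complex.add_im, Complex.mul_im]
      ring
    have h3 : ((A + Complex.I * Real.cos t) ^ 2 : ℂ).re = A ^ 2 - Real.cos t ^ 2 := by
      simp only [pow_two, Complex.add_re, Complex.mul_re, Complex.I_re, Complex.I_im,
        Complex.ofReal_re, Complex.ofReal_im, Complex.add_im, Complex.mul_im]
      ring
    rw [one_div, Complex.inv_re, h2, h3]
    field_simp
    ring
  have hder : ∫ t in (-Real.pi)..Real.pi, (2 * Real.cos t ^ 2 * A ^ 2 - A ^ 2 + Real.cos t ^ 2) /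
      (A ^ 2 + Real.cos t ^ 2) ^ 2 = 0 := by
    rw [intervalIntegral.integral_eq_sub_of_hasDerivAt
      (f := fun t => Real.sin t * Real.cos t / (A ^ 2 + Real.cos t ^ 2))]
    · simp
    · intro t _
      have := ((Real.hasDerivAt_sin t).mul (Real.hasDerivAt_cos t)).div
        (((Real.hasDerivAt_cos t).pow 2).const_add (A ^ 2)) (hpos t).ne'
      refine this.congr_deriv (congrArg₂ (· / ·) ?_ rfl)
      simp only [Pi.mul_apply, Pi.pow_apply, Nat.cast_ofNat, Nat.add_one_sub_one, pow_one]
      linear_combination (Real.cos t ^ 2 - A ^ 2) * Real.sin_sq t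
    · exact hc2.intervalIntegrable _ _
  intro h0
  rw [← integral_Ioc_eq_integral_Ioo, ← intervalIntegral.integral_of_le hpi] at h0
  have hre0 : ∫ t in (-Real.pi)..Real.pi, (1 / ((A : ℂ) + Complex.I * Real.cos t) ^ 2).re = 0 := by
    have := Complex.reCLM.intervalIntegral_comp_comm
      (hcont.intervalIntegrable (μ := volume) (-Real.pi) Real.pi)
    rw [h0] at this
    simpa using this
  simp only [hre] at hre0
  rw [intervalIntegral.integral_sub ((hc1.const_mul _).intervalIntegrable _ _)
    ((hc2.const_mul _).intervalIntegrable _ _), intervalIntegral.integral_const_mul,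
    intervalIntegral.integral_const_mul, hder, mul_zero, sub_zero] at hre0
  have : 0 < ∫ t in (-Real.pi)..Real.pi, 1 / (A ^ 2 + Real.cos t ^ 2) :=
    intervalIntegral.intervalIntegral_pos_of_pos (hc1.intervalIntegrable _ _)
      (fun t => one_div_pos.2 (hpos t)) (by linarith [Real.pi_pos])
  have : 0 < A ^ 2 / (A ^ 2 + 1) * ∫ t in (-Real.pi)..Real.pi, 1 / (A ^ 2 + Real.cos t ^ 2) := by
    positivity
  linarith

/-- In polar coordinates the exponent is linear in the radius, so the radial integral is explicit
and leaves the angular integral of `(A + i cos t)⁻²`. -/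
theorem integral_plane_cexp_ne_zero {A : ℝ} (hA : 0 < A) :
    ∫ p : ℝ × ℝ, Complex.exp (-((A : ℂ) * Real.sqrt (p.1 ^ 2 + p.2 ^ 2) + Complex.I * p.1)) ≠ 0 := by
  have hint : Integrable (fun p : ℝ × ℝ =>
      (p.1 : ℂ) * Complex.exp (-(((A : ℂ) + Complex.I * Real.cos p.2) * p.1)))
      ((volume.restrict (Ioi 0)).prod (volume.restrict (Ioo (-Real.pi) Real.pi))) := by
    have h1 := Integrable.mul_prod (integrableOn_mul_exp_neg_mul_Ioi hA)
      (integrable_const (μ := volume.restrict (Ioo (-Real.pi) Real.pi)) (1 : ℝ))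
    refine h1.mono' (Continuous.aestronglyMeasurable (by fun_prop)) ?_
    rw [Measure.prod_restrict]
    filter_upwards [ae_restrict_mem (measurableSet_Ioi.prod measurableSet_Ioo)] with p hp
    rw [norm_mul, norm_cexp_neg_mul_ofReal, Complex.norm_real, Real.norm_of_nonneg (le_of_lt hp.1)]
    simp [-Complex.ofReal_cos]
  have hcongr : ∀ p ∈ Ioi (0 : ℝ) ×ˢ Ioo (-Real.pi) Real.pi,
      p.1 • Complex.exp (-((A : ℂ) * Real.sqrt ((polarCoord.symm p).1 ^ 2 +
        (polarCoord.symm p).2 ^ 2) + Complex.I * (polarCoord.symm p).1)) =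
      (p.1 : ℂ) * Complex.exp (-(((A : ℂ) + Complex.I * Real.cos p.2) * p.1)) := fun p hp => by
    have h1 : (polarCoord.symm p).1 = p.1 * Real.cos p.2 := rfl
    have h2 : (polarCoord.symm p).2 = p.1 * Real.sin p.2 := rfl
    have h3 : (p.1 * Real.cos p.2) ^ 2 + (p.1 * Real.sin p.2) ^ 2 = p.1 ^ 2 := by
      linear_combination p.1 ^ 2 * Real.sin_sq_add_cos_sq p.2
    rw [h1, h2, h3, Real.sqrt_sq (le_of_lt hp.1), Complex.real_smul]
    congr 2
    push_cast
    ring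
  rw [← integral_comp_polarCoord_symm, polarCoord_target,
    setIntegral_congr_fun (measurableSet_Ioi.prod measurableSet_Ioo) hcongr,
    Measure.volume_eq_prod, ← Measure.prod_restrict, integral_prod_symm _ hint]
  have hin : ∀ t : ℝ, ∫ r in Ioi (0 : ℝ),
      (r : ℂ) * Complex.exp (-(((A : ℂ) + Complex.I * Real.cos t) * r)) =
        1 / ((A : ℂ) + Complex.I * Real.cos t) ^ 2 := fun t =>
    integral_mul_cexp_neg_mul_Ioi (by simpa [-Complex.ofReal_cos] using hA)
  simp only [hin]
  exact integral_inv_sq_add_I_mul_cos_ne_zero hA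

/-- This form shows at once that the cone is open and scale invariant, and it gives the bound of
`exp(-τ a · x)` by `exp(-τ cos θ0 |x|)`. -/
theorem mem_cone_iff {a x : R3} (ha : ‖a‖ = 1) {θ0 : ℝ} (hθ0 : 0 < θ0) (hθ0' : θ0 < Real.pi / 2) :
    x ∈ cone a θ0 ↔ Real.cos θ0 * ‖x‖ < inner ℝ a x := by
  have hpi := Real.pi_pos
  rcases eq_or_ne x 0 with rfl | hx
  · simp [cone, hθ0'.le]
  · have hx' : 0 < ‖x‖ := norm_pos_iff.2 hx
    have h1 := InnerProductGeometry.cos_angle_mul_norm_mul_norm x a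
    rw [ha, mul_one, real_inner_comm] at h1
    rw [← h1, mul_lt_mul_iff_left₀ hx']
    exact (Real.strictAntiOn_cos.lt_iff_gt ⟨hθ0.le, by linarith⟩
      ⟨InnerProductGeometry.angle_nonneg _ _, InnerProductGeometry.angle_le_pi _ _⟩).symm

theorem isOpen_cone {a : R3} (ha : ‖a‖ = 1) {θ0 : ℝ} (hθ0 : 0 < θ0) (hθ0' : θ0 < Real.pi / 2) :
    IsOpen (cone a θ0) := by
  have : cone a θ0 = {x | Real.cos θ0 * ‖x‖ < inner ℝ a x} :=
    Set.ext fun x => mem_cone_iff ha hθ0 hθ0'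
  rw [this]
  exact isOpen_lt (by fun_prop) (by fun_prop)

theorem integrable_norm_pow_mul_exp_neg {c : ℝ} (hc : 0 < c) (n : ℕ) :
    Integrable (fun x : R3 => ‖x‖ ^ n * Real.exp (-(c * ‖x‖))) := by
  rw [integrable_fun_norm_addHaar volume (f := fun r : ℝ => r ^ n * Real.exp (-(c * r)))]
  have := integrableOn_rpow_mul_exp_neg_mul_rpow (s := n + 2) (p := 1)
    (by have : (0 : ℝ) ≤ n := n.cast_nonneg
        linarith) one_pos hc
  refine this.congr_fun (fun r hr => ?_) measurableSet_Ioi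
  have h2 : r ^ ((n : ℝ) + 2) = r ^ (n + 2) := by exact_mod_cast Real.rpow_natCast r (n + 2)
  simp only [h2, Real.rpow_one, finrank_euclideanSpace, Fintype.card_fin, Nat.add_one_sub_one,
    smul_eq_mul, neg_mul]
  ring

theorem integrable_exp_neg_mul_norm {c : ℝ} (hc : 0 < c) :
    Integrable (fun x : R3 => Real.exp (-(c * ‖x‖))) := by
  simpa using integrable_norm_pow_mul_exp_neg hc 0

theorem norm_cexp_neg_add_I_mul (s t : ℝ) :
    ‖Complex.exp (-((s : ℂ) + Complex.I * t))‖ = Real.exp (-s) := by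
  rw [Complex.norm_exp]; simp

theorem integrableOn_cone_cexp {a b : R3} (ha : ‖a‖ = 1)
    {θ0 : ℝ} (hθ0 : 0 < θ0) (hθ0' : θ0 < Real.pi / 2) :
    IntegrableOn (fun x : R3 => Complex.exp (-(((inner ℝ a x : ℝ) : ℂ) +
      Complex.I * (inner ℝ b x : ℝ)))) (cone a θ0) := by
  have hcos : 0 < Real.cos θ0 := Real.cos_pos_of_mem_Ioo ⟨by linarith, hθ0'⟩
  refine (integrable_exp_neg_mul_norm hcos).integrableOn.mono'
    (Continuous.aestronglyMeasurable (by fun_prop)) ?_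
  filter_upwards [ae_restrict_mem (isOpen_cone ha hθ0 hθ0').measurableSet] with x hx
  rw [norm_cexp_neg_add_I_mul]
  exact Real.exp_le_exp.2 (neg_le_neg ((mem_cone_iff ha hθ0 hθ0').1 hx).le)

/-- In orthonormal coordinates with first axes `a` and `b` the cone is the region above the graph of
`A √(y² + z²)`, `A = cot θ0`. Integrating `exp(-t)` along the axis leaves a nonvanishing integral
over the plane. -/
theorem integral_cone_cexp_ne_zero {a b : R3} (ha : ‖a‖ = 1) (hb : ‖b‖ = 1)
    (hab : inner ℝ a b = 0) {θ0 : ℝ} (hθ0 : 0 < θ0) (hθ0' : θ0 < Real.pi / 2) :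
    ∫ x in cone a θ0, Complex.exp (-(((inner ℝ a x : ℝ) : ℂ) +
      Complex.I * (inner ℝ b x : ℝ))) ≠ 0 := by
  obtain ⟨Ψ, hΨ, h1, h2, h3⟩ := exists_measurableEquiv_coords ha hb hab
  have hcos : 0 < Real.cos θ0 := Real.cos_pos_of_mem_Ioo ⟨by linarith, hθ0'⟩
  have hsin : 0 < Real.sin θ0 := Real.sin_pos_of_pos_of_lt_pi hθ0 (by linarith)
  set A : ℝ := Real.cos θ0 / Real.sin θ0 with hA
  have hA0 : 0 < A := div_pos hcos hsin
  let F : ℝ × ℝ × ℝ → ℂ := fun q => (Ioi (A * Real.sqrt (q.2.1 ^ 2 + q.2.2 ^ 2))).indicator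
    (fun t : ℝ => Complex.exp (-((t : ℂ) + Complex.I * q.2.1))) q.1
  have hmem : ∀ x, x ∈ cone a θ0 ↔
      (Ψ x).1 ∈ Ioi (A * Real.sqrt ((Ψ x).2.1 ^ 2 + (Ψ x).2.2 ^ 2)) := fun x => by
    rw [mem_cone_iff ha hθ0 hθ0', ← h1, mem_Ioi, hA, div_mul_eq_mul_div, div_lt_iff₀ hsin]
    set ρ := Real.sqrt ((Ψ x).2.1 ^ 2 + (Ψ x).2.2 ^ 2) with hρ
    have hρ0 : 0 ≤ ρ := Real.sqrt_nonneg _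
    have hρ2 : ρ ^ 2 = (Ψ x).2.1 ^ 2 + (Ψ x).2.2 ^ 2 := Real.sq_sqrt (by positivity)
    have h3 := h3 x
    rw [← hρ2] at h3
    have hn := norm_nonneg x
    have hsc := Real.sin_sq_add_cos_sq θ0
    -- After squaring, `|x|² = t² + ρ²` and `sin² + cos² = 1` make the two inequalities the same;
    -- positivity of the axial coordinate then allows roots to be taken.
    have key : (Real.cos θ0 * ‖x‖) ^ 2 < (Ψ x).1 ^ 2 ↔
        (Real.cos θ0 * ρ) ^ 2 < ((Ψ x).1 * Real.sin θ0) ^ 2 := by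
      rw [mul_pow, mul_pow, mul_pow, h3]
      constructor <;> intro h <;> nlinarith
    constructor
    · intro h
      have ht : 0 < (Ψ x).1 := lt_of_le_of_lt (by positivity) h
      exact lt_of_pow_lt_pow_left₀ 2 (by positivity)
        (key.1 (pow_lt_pow_left₀ h (by positivity) two_ne_zero))
    · intro h
      have ht : 0 < (Ψ x).1 := pos_of_mul_pos_left (lt_of_le_of_lt (by positivity) h) hsin.le
      exact lt_of_pow_lt_pow_left₀ 2 ht.le
        (key.2 (pow_lt_pow_left₀ h (by positivity) two_ne_zero))
  have hcone := (isOpen_cone ha hθ0 hθ0').measurableSet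
  have hF : ∀ x, (cone a θ0).indicator (fun x => Complex.exp (-(((inner ℝ a x : ℝ) : ℂ) +
      Complex.I * (inner ℝ b x : ℝ)))) x = F (Ψ x) := fun x => by
    by_cases hx : x ∈ cone a θ0
    · simp only [F]
      rw [indicator_of_mem hx, indicator_of_mem ((hmem x).1 hx), h1, h2]
    · simp only [F]
      rw [indicator_of_notMem hx, indicator_of_notMem fun h => hx ((hmem x).2 h)]
  have hint : Integrable F := by
    rw [← hΨ.integrable_comp_emb Ψ.measurableEmbedding]
    have := (integrable_indicator_iff hcone).2 (integrableOn_cone_cexp (b := b) ha hθ0 hθ0')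
    exact this.congr (.of_forall hF)
  rw [← integral_indicator hcone, integral_congr_ae (.of_forall hF), hΨ.integral_comp' F,
    Measure.volume_eq_prod, integral_prod_symm _ hint]
  have hin : ∀ p : ℝ × ℝ, ∫ t, F (t, p) =
      Complex.exp (-((A : ℂ) * Real.sqrt (p.1 ^ 2 + p.2 ^ 2) + Complex.I * p.1)) := fun p => by
    have hexp : ∀ t : ℝ, Complex.exp (-((t : ℂ) + Complex.I * p.1)) =
        ((Real.exp (-t) : ℝ) : ℂ) * Complex.exp (-(Complex.I * p.1)) := fun t => by
      rw [neg_add, Complex.exp_add]; push_cast; rfl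
    simp only [F]
    rw [integral_indicator measurableSet_Ioi]
    simp only [hexp]
    rw [integral_mul_const, integral_complex_ofReal, integral_exp_neg_Ioi, neg_add, Complex.exp_add]
    push_cast
    rfl
  simp only [hin]
  exact integral_plane_cexp_ne_zero hA0

/-! ### Vector algebra on `ℂ³` and exponential solutions of the Maxwell system. -/

/-- The complexification of a real vector. -/
def toC3 (v : R3) : C3 := WithLp.toLp 2 fun i => (v i : ℂ)

/-- The cross product on `ℂ³`. -/
def cross (u v : C3) : C3 :=
  !₂[u 1 * v 2 - u 2 * v 1, u 2 * v 0 - u 0 * v 2, u 0 * v 1 - u 1 * v 0]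

/-- The gradient of a complex-valued function. -/
def grad (f : R3 → ℂ) (x : R3) : C3 :=
  WithLp.toLp 2 fun i => fderiv ℝ f x (EuclideanSpace.single i 1)

@[simp] theorem toC3_apply (v : R3) (i : Fin 3) : toC3 v i = (v i : ℂ) := rfl

@[simp] theorem grad_apply (f : R3 → ℂ) (x : R3) (i : Fin 3) :
    grad f x i = fderiv ℝ f x (EuclideanSpace.single i 1) := rfl

@[simp] theorem cross_zero_apply (u v : C3) : cross u v 0 = u 1 * v 2 - u 2 * v 1 := rfl
@[simp] theorem cross_one_apply (u v : C3) : cross u v 1 = u 2 * v 0 - u 0 * v 2 := rfl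
@[simp] theorem cross_two_apply (u v : C3) : cross u v 2 = u 0 * v 1 - u 1 * v 0 := rfl

theorem C3.ext_iff {u v : C3} : u = v ↔ u 0 = v 0 ∧ u 1 = v 1 ∧ u 2 = v 2 := by
  refine ⟨fun h => by simp [h], fun ⟨h0, h1, h2⟩ => ?_⟩
  ext i
  fin_cases i <;> assumption

theorem norm_toC3 (v : R3) : ‖toC3 v‖ = ‖v‖ := by
  simp [EuclideanSpace.norm_eq, toC3]

theorem norm_apply_le (u : C3) (i : Fin 3) : ‖u i‖ ≤ ‖u‖ := PiLp.norm_apply_le u i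

theorem norm_le_sum_norm (u : C3) : ‖u‖ ≤ ‖u 0‖ + ‖u 1‖ + ‖u 2‖ := by
  refine le_of_sq_le_sq ?_ (by positivity)
  rw [EuclideanSpace.norm_sq_eq, Fin.sum_univ_three]
  nlinarith [mul_nonneg (norm_nonneg (u 0)) (norm_nonneg (u 1)),
    mul_nonneg (norm_nonneg (u 0)) (norm_nonneg (u 2)),
    mul_nonneg (norm_nonneg (u 1)) (norm_nonneg (u 2))]

theorem norm_cross_le (u v : C3) : ‖cross u v‖ ≤ 6 * (‖u‖ * ‖v‖) := by
  have h : ∀ i j : Fin 3, ‖u i * v j - u j * v i‖ ≤ 2 * (‖u‖ * ‖v‖) := fun i j => by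
    have h1 : ‖u i * v j‖ ≤ ‖u‖ * ‖v‖ := by
      rw [norm_mul]; gcongr <;> exact norm_apply_le _ _
    have h2 : ‖u j * v i‖ ≤ ‖u‖ * ‖v‖ := by
      rw [norm_mul]; gcongr <;> exact norm_apply_le _ _
    linarith [norm_sub_le (u i * v j) (u j * v i)]
  have := norm_le_sum_norm (cross u v)
  simp only [cross_zero_apply, cross_one_apply, cross_two_apply] at this
  linarith [h 1 2, h 2 0, h 0 1]

theorem cdot_eq (u v : C3) : cdot u v = u 0 * v 0 + u 1 * v 1 + u 2 * v 2 := by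
  simp [cdot, Fin.sum_univ_three]

theorem cdot_add (u v w : C3) : cdot u (v + w) = cdot u v + cdot u w := by
  simp [cdot_eq]; ring

theorem cdot_smul (c : ℂ) (u v : C3) : cdot u (c • v) = c * cdot u v := by
  simp [cdot_eq]; ring

theorem smul_cdot (c : ℂ) (u v : C3) : cdot (c • u) v = c * cdot u v := by
  simp [cdot_eq]; ring

theorem sub_cdot (u v w : C3) : cdot (u - v) w = cdot u w - cdot v w := by
  simp [cdot_eq]; ring

theorem norm_cdot_le (u v : C3) : ‖cdot u v‖ ≤ 3 * (‖u‖ * ‖v‖) := by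
  have h : ∀ i : Fin 3, ‖u i * v i‖ ≤ ‖u‖ * ‖v‖ := fun i => by
    rw [norm_mul]; gcongr <;> exact norm_apply_le _ _
  rw [cdot_eq]
  linarith [norm_add₃_le (a := u 0 * v 0) (b := u 1 * v 1) (c := u 2 * v 2), h 0, h 1, h 2]

theorem real_inner_eq (u v : R3) : inner ℝ u v = u 0 * v 0 + u 1 * v 1 + u 2 * v 2 := by
  simp [PiLp.inner_apply, Fin.sum_univ_three, mul_comm]

theorem curl_smul_const {f : R3 → ℂ} {x : R3} (hf : DifferentiableAt ℝ f x) (P : C3) :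
    curl (fun y => f y • P) x = cross (grad f x) P := by
  have h : ∀ i k, partialDeriv i k (fun y => f y • P) x = grad f x i * P k := fun i k => by
    have : HasFDerivAt (fun y => f y • P) _ x := hf.hasFDerivAt.smul_const P
    simp [partialDeriv, this.fderiv]
  simp only [curl, h]
  rw [C3.ext_iff]
  simp [mul_comm]

/-- The complex plane wave `exp (-(τ a + i σ b) · x)`. -/
def cgo (a b : R3) (τ σ : ℝ) (x : R3) : ℂ :=
  Complex.exp (-(((τ * inner ℝ a x : ℝ) : ℂ) + Complex.I * (σ * inner ℝ b x : ℝ)))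

theorem contDiff_cgo (a b : R3) (τ σ : ℝ) : ContDiff ℝ (⊤ : ℕ∞) (cgo a b τ σ) := by
  have h : ∀ (s : ℝ) (v : R3), ContDiff ℝ (⊤ : ℕ∞) fun x : R3 => ((s * inner ℝ v x : ℝ) : ℂ) :=
    fun s v => Complex.ofRealCLM.contDiff.comp (contDiff_const.mul (contDiff_const.inner ℝ contDiff_id))
  exact (((h τ a).add (contDiff_const.mul (h σ b))).neg).cexp

theorem norm_cgo (a b : R3) (τ σ : ℝ) (x : R3) :
    ‖cgo a b τ σ x‖ = Real.exp (-(τ * inner ℝ a x)) :=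
  norm_cexp_neg_add_I_mul _ _

/-- The wave vector of `cgo a b τ σ`. -/
def waveVec (a b : R3) (τ σ : ℝ) : C3 := -((τ : ℂ) • toC3 a + (Complex.I * σ) • toC3 b)

theorem grad_cgo (a b : R3) (τ σ : ℝ) (x : R3) :
    grad (cgo a b τ σ) x = cgo a b τ σ x • waveVec a b τ σ := by
  have h : ∀ (s : ℝ) (v : R3), HasFDerivAt (fun x : R3 => ((s * inner ℝ v x : ℝ) : ℂ))
      (Complex.ofRealCLM.comp (s • innerSL ℝ v)) x := fun s v =>
    Complex.ofRealCLM.hasFDerivAt.comp x (((innerSL ℝ v).hasFDerivAt).const_mul s)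
  have h2 : HasFDerivAt (cgo a b τ σ) _ x :=
    ((h τ a).add ((h σ b).const_mul Complex.I)).neg.cexp
  have : ∀ i, grad (cgo a b τ σ) x i = cgo a b τ σ x * waveVec a b τ σ i := fun i => by
    rw [grad_apply, h2.fderiv]
    simp [waveVec, cgo, EuclideanSpace.inner_single_right]
    ring
  rw [C3.ext_iff]
  exact ⟨this 0, this 1, this 2⟩

theorem grad_mul {f g : R3 → ℂ} {x : R3} (hf : DifferentiableAt ℝ f x)
    (hg : DifferentiableAt ℝ g x) :
    grad (fun y => f y * g y) x = f x • grad g x + g x • grad f x := by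
  have : HasFDerivAt (fun y => f y * g y) _ x := hf.hasFDerivAt.mul hg.hasFDerivAt
  rw [C3.ext_iff]
  simp [this.fderiv]

theorem curl_cutoff_cgo {χ : R3 → ℂ} (hχ : Differentiable ℝ χ) (a b : R3) (τ σ : ℝ) (P : C3)
    (x : R3) :
    curl (fun y => (χ y * cgo a b τ σ y) • P) x =
      (χ x * cgo a b τ σ x) • cross (waveVec a b τ σ) P +
        cgo a b τ σ x • cross (grad χ x) P := by
  have he : Differentiable ℝ (cgo a b τ σ) := (contDiff_cgo a b τ σ).differentiable (by simp)
  rw [curl_smul_const (f := fun y => χ y * cgo a b τ σ y) ((hχ x).mul (he x)),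
    grad_mul (hχ x) (he x), grad_cgo, C3.ext_iff]
  simp only [cross_zero_apply, cross_one_apply, cross_two_apply, PiLp.add_apply, PiLp.smul_apply,
    smul_eq_mul]
  refine ⟨?_, ?_, ?_⟩ <;> ring

/-- The polarization of the electric part of the exponential Maxwell solution. -/
def elecPol (a b : R3) (τ σ : ℝ) : C3 := ((σ / τ : ℝ) : ℂ) • toC3 a + Complex.I • toC3 b

/-- Only the mixed terms survive, with coefficient `i (σ² / τ - τ)`. The cancellation of the order
`τ` is what makes the magnetic polarization a factor `1 / τ` smaller than the electric one. -/
theorem cross_waveVec_elecPol {a b : R3} {τ σ k : ℝ} (hτ : τ ≠ 0) (hσ : σ ^ 2 = τ ^ 2 + k) :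
    cross (waveVec a b τ σ) (elecPol a b τ σ) =
      (Complex.I * (k / τ : ℝ)) • cross (toC3 a) (toC3 b) := by
  have h : -(Complex.I * τ) + Complex.I * σ * (σ / τ : ℝ) = Complex.I * (k / τ : ℝ) := by
    have : (-τ + σ * (σ / τ) : ℝ) = k / τ := by
      field_simp; linarith
    rw [← this]; push_cast; ring
  rw [← h, C3.ext_iff]
  simp only [cross_zero_apply, cross_one_apply, cross_two_apply, PiLp.add_apply, PiLp.smul_apply,
    smul_eq_mul, waveVec, elecPol, PiLp.neg_apply, toC3_apply]
  refine ⟨?_, ?_, ?_⟩ <;> ring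

theorem cross_waveVec_cross {a b : R3} (ha : ‖a‖ = 1) (hb : ‖b‖ = 1) (hab : inner ℝ a b = 0)
    {τ σ : ℝ} (hτ : τ ≠ 0) :
    cross (waveVec a b τ σ) (cross (toC3 a) (toC3 b)) =
      (-(Complex.I * τ)) • elecPol a b τ σ := by
  have haa : ((a 0 * a 0 + a 1 * a 1 + a 2 * a 2 : ℝ) : ℂ) = 1 := by
    rw [← real_inner_eq, real_inner_self_eq_norm_sq, ha]; norm_num
  have hbb : ((b 0 * b 0 + b 1 * b 1 + b 2 * b 2 : ℝ) : ℂ) = 1 := by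
    rw [← real_inner_eq, real_inner_self_eq_norm_sq, hb]; norm_num
  have hab' : ((a 0 * b 0 + a 1 * b 1 + a 2 * b 2 : ℝ) : ℂ) = 0 := by
    rw [← real_inner_eq, hab]; norm_num
  push_cast at haa hbb hab'
  have hτ' : (τ : ℂ) ≠ 0 := by exact_mod_cast hτ
  have h : (τ : ℂ) * (σ / τ : ℝ) = σ := by push_cast; field_simp
  have h2 : (-(Complex.I * τ)) • elecPol a b τ σ =
      (-(Complex.I * σ)) • toC3 a + (τ : ℂ) • toC3 b := by
    rw [elecPol, smul_add, smul_smul, smul_smul]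
    congr 2
    · rw [neg_mul, mul_assoc, h]
    · linear_combination (-(τ : ℂ)) * Complex.I_mul_I
  rw [h2, C3.ext_iff]
  simp only [cross_zero_apply, cross_one_apply, cross_two_apply, PiLp.add_apply, PiLp.smul_apply,
    smul_eq_mul, waveVec, PiLp.neg_apply, toC3_apply]
  -- The constants `1` and `0` are written back as the dot products of `a` and `b`, so that each
  -- component becomes a polynomial identity (the triple product expansion).
  have key : ∀ i, -(Complex.I * σ) * a i + τ * b i =
      -(Complex.I * σ) * (a i * (b 0 * b 0 + b 1 * b 1 + b 2 * b 2) -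
        b i * (a 0 * b 0 + a 1 * b 1 + a 2 * b 2)) +
      -τ * (a i * (a 0 * b 0 + a 1 * b 1 + a 2 * b 2) -
        b i * (a 0 * a 0 + a 1 * a 1 + a 2 * a 2)) := fun i => by
    rw [haa, hbb, hab']; ring
  refine ⟨?_, ?_, ?_⟩
  · rw [key]; ring
  · rw [key]; ring
  · rw [key]; ring

/-- The polarization of the magnetic part of the exponential Maxwell solution. -/
def magPol (a b : R3) (s : ℝ) : C3 := (s : ℂ) • cross (toC3 a) (toC3 b)

/-! ### The transmission identities tested with a truncated exponential solution. -/

theorem aestronglyMeasurable_cdot {ν : Measure R3} {U F : R3 → C3} (hU : AEStronglyMeasurable U ν)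
    (hF : AEStronglyMeasurable F ν) : AEStronglyMeasurable (fun x => cdot (U x) (F x)) ν := by
  unfold cdot
  fun_prop

theorem integrable_cdot {ν : Measure R3} {U F : R3 → C3} (hU : Integrable U ν)
    (hF : AEStronglyMeasurable F ν) {C : ℝ} (hC : ∀ x, ‖F x‖ ≤ C) :
    Integrable (fun x => cdot (U x) (F x)) ν := by
  refine ((Integrable.norm hU).const_mul (3 * C)).mono'
    (aestronglyMeasurable_cdot hU.aestronglyMeasurable hF) (.of_forall fun x => ?_)
  have h1 := mul_le_mul_of_nonneg_left (hC x) (norm_nonneg (U x))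
  linarith [norm_cdot_le (U x) (F x)]

theorem integrableOn_cdot {K : Set R3} {U F : R3 → C3} (hU : IntegrableOn U K)
    (hF : Continuous F) (hFc : HasCompactSupport F) :
    IntegrableOn (fun x => cdot (U x) (F x)) K := by
  obtain ⟨C, hC⟩ : ∃ C, ∀ x, ‖F x‖ ≤ C := hFc.exists_bound_of_continuous hF
  exact integrable_cdot hU hF.aestronglyMeasurable hC

theorem continuous_cross : Continuous fun p : C3 × C3 => cross p.1 p.2 := by
  refine (PiLp.continuous_toLp 2 _).comp (continuous_pi fun i => ?_)
  fin_cases i <;> simp <;> fun_prop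

theorem continuous_grad {f : R3 → ℂ} (hf : ContDiff ℝ (⊤ : ℕ∞) f) : Continuous (grad f) := by
  refine (PiLp.continuous_toLp 2 _).comp (continuous_pi fun i => ?_)
  exact (hf.continuous_fderiv (by simp)).clm_apply continuous_const

theorem hasCompactSupport_grad {f : R3 → ℂ} (hf : HasCompactSupport f) :
    HasCompactSupport (grad f) := by
  refine (hf.fderiv (𝕜 := ℝ)).mono fun x hx hx' => hx ?_
  rw [C3.ext_iff]
  simp [hx']

/-- Testing the magnetic curl identity with `χ e P` and the electric one with `χ e Q` and adding
eliminates the bulk integrals of `E0` and `H0`, because `(e P, e Q)` satisfies the background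
equations. These fields remain only paired with `grad χ`. -/
theorem cutoff_cgo_identity {K : Set R3} {a b : R3} (ha : ‖a‖ = 1) (hb : ‖b‖ = 1)
    (hab : inner ℝ a b = 0) {χ : R3 → ℂ} (hχ : ContDiff ℝ (⊤ : ℕ∞) χ) (hχc : HasCompactSupport χ)
    {E H E0 H0 : R3 → C3} (hEi : IntegrableOn E K) (hHi : IntegrableOn H K)
    (hE0i : IntegrableOn E0 K) (hH0i : IntegrableOn H0 K) {ω μ γ μ0 ε0 : ℝ}
    (hE : ∀ φ : R3 → C3, ContDiff ℝ (⊤ : ℕ∞) φ → tsupport φ ⊆ tsupport χ →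
      ∫ x in K, cdot ((Complex.I * ω) • ((μ : ℂ) • H x - (μ0 : ℂ) • H0 x)) (φ x) =
        ∫ x in K, cdot (E x - E0 x) (curl φ x))
    (hH : ∀ φ : R3 → C3, ContDiff ℝ (⊤ : ℕ∞) φ → tsupport φ ⊆ tsupport χ →
      ∫ x in K, cdot ((-(Complex.I * ω)) • ((γ : ℂ) • E x - (ε0 : ℂ) • E0 x)) (φ x) =
        ∫ x in K, cdot (H x - H0 x) (curl φ x))
    {τ σ : ℝ} (hτ : 0 < τ) (hσ : σ ^ 2 = τ ^ 2 + ω ^ 2 * ε0 * μ0) :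
    (Complex.I * ω * (γ - ε0)) *
        ∫ x in K, cdot (E x) ((χ x * cgo a b τ σ x) • elecPol a b τ σ) =
      (Complex.I * ω * (μ - μ0)) *
        (∫ x in K, cdot (H x) ((χ x * cgo a b τ σ x) • magPol a b (ω * ε0 / τ))) -
      (∫ x in K, cdot (H x - H0 x) (cgo a b τ σ x • cross (grad χ x) (elecPol a b τ σ))) -
      ∫ x in K, cdot (E x - E0 x) (cgo a b τ σ x • cross (grad χ x) (magPol a b (ω * ε0 / τ))) := by
  set P := elecPol a b τ σ with hP
  set Q := magPol a b (ω * ε0 / τ) with hQ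
  have he := contDiff_cgo a b τ σ
  have hχe : ContDiff ℝ (⊤ : ℕ∞) fun x => χ x * cgo a b τ σ x := hχ.mul he
  have hcs : ∀ V : C3, HasCompactSupport fun x => (χ x * cgo a b τ σ x) • V := fun V =>
    hχc.mono fun x hx hx' => hx (by simp only [hx', zero_mul, zero_smul])
  have hts : ∀ V : C3, tsupport (fun x => (χ x * cgo a b τ σ x) • V) ⊆ tsupport χ := fun V =>
    closure_mono fun x hx hx' => hx (by simp only [hx', zero_mul, zero_smul])
  have hcd : ∀ V : C3, ContDiff ℝ (⊤ : ℕ∞) fun x => (χ x * cgo a b τ σ x) • V := fun V =>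
    hχe.smul contDiff_const
  have hgc : ∀ V : C3, Continuous fun x => cgo a b τ σ x • cross (grad χ x) V := fun V =>
    he.continuous.smul (continuous_cross.comp ((continuous_grad hχ).prodMk continuous_const))
  have hgs : ∀ V : C3, HasCompactSupport fun x => cgo a b τ σ x • cross (grad χ x) V := fun V =>
    (hasCompactSupport_grad hχc).mono fun x hx hx' => hx (by
      rw [C3.ext_iff]; simp [hx'])
  -- This equation fixes the scalar `ω ε0 / τ` in `Q`: the factor `i ω² ε0 μ0 / τ` equals `i ω μ0`
  -- times it.
  have hcrossP : cross (waveVec a b τ σ) P = (Complex.I * ω * μ0) • Q := by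
    rw [hP, cross_waveVec_elecPol hτ.ne' hσ, hQ, magPol, smul_smul]
    congr 1
    push_cast
    ring
  have hcrossQ : cross (waveVec a b τ σ) Q = (-(Complex.I * ω * ε0)) • P := by
    have h1 : ∀ (c : ℂ) (u v : C3), cross u (c • v) = c • cross u v := fun c u v => by
      rw [C3.ext_iff]; simp; refine ⟨?_, ?_, ?_⟩ <;> ring
    rw [hQ, magPol, h1, cross_waveVec_cross ha hb hab hτ.ne', smul_smul]
    congr 1
    have : (τ : ℂ) ≠ 0 := by exact_mod_cast hτ.ne'
    push_cast
    field_simp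
  have hint : ∀ U : R3 → C3, IntegrableOn U K → ∀ V : C3,
      IntegrableOn (fun x => cdot (U x) ((χ x * cgo a b τ σ x) • V)) K := fun U hU V =>
    integrableOn_cdot hU (hcd V).continuous (hcs V)
  have hleft : ∀ (c s t : ℂ) (U U0 : R3 → C3), IntegrableOn U K → IntegrableOn U0 K → ∀ V : C3,
      ∫ x in K, cdot (c • (s • U x - t • U0 x)) ((χ x * cgo a b τ σ x) • V) =
        c * (s * (∫ x in K, cdot (U x) ((χ x * cgo a b τ σ x) • V)) -
          t * ∫ x in K, cdot (U0 x) ((χ x * cgo a b τ σ x) • V)) := by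
    intro c s t U U0 hU hU0 V
    simp only [smul_cdot, sub_cdot]
    rw [integral_const_mul, integral_sub ((hint U hU V).const_mul s) ((hint U0 hU0 V).const_mul t),
      integral_const_mul, integral_const_mul]
  have hright : ∀ (c : ℂ) (U U0 : R3 → C3), IntegrableOn U K → IntegrableOn U0 K → ∀ V W : C3,
      cross (waveVec a b τ σ) V = c • W →
      ∫ x in K, cdot (U x - U0 x) (curl (fun y => (χ y * cgo a b τ σ y) • V) x) =
        c * ((∫ x in K, cdot (U x) ((χ x * cgo a b τ σ x) • W)) -
          ∫ x in K, cdot (U0 x) ((χ x * cgo a b τ σ x) • W)) +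
        ∫ x in K, cdot (U x - U0 x) (cgo a b τ σ x • cross (grad χ x) V) := by
    intro c U U0 hU hU0 V W hVW
    have h1 : ∀ x, cdot (U x - U0 x) (curl (fun y => (χ y * cgo a b τ σ y) • V) x) =
        c * (cdot (U x) ((χ x * cgo a b τ σ x) • W) - cdot (U0 x) ((χ x * cgo a b τ σ x) • W)) +
          cdot (U x - U0 x) (cgo a b τ σ x • cross (grad χ x) V) := fun x => by
      rw [curl_cutoff_cgo (hχ.differentiable (by simp)), hVW, cdot_add, smul_comm _ c, cdot_smul,
        sub_cdot]
    simp only [h1]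
    have hUU : IntegrableOn (fun x => U x - U0 x) K := hU.sub hU0
    have h2 : Integrable (fun x => c * (cdot (U x) ((χ x * cgo a b τ σ x) • W) -
        cdot (U0 x) ((χ x * cgo a b τ σ x) • W))) (volume.restrict K) :=
      ((hint U hU W).sub (hint U0 hU0 W)).const_mul c
    rw [integral_add h2 (integrableOn_cdot hUU (hgc V) (hgs V)), integral_const_mul,
      integral_sub (hint U hU W) (hint U0 hU0 W)]
  have h1 := hH _ (hcd P) (hts P)
  have h2 := hE _ (hcd Q) (hts Q)
  rw [hleft _ _ _ E E0 hEi hE0i, hright _ H H0 hHi hH0i P Q hcrossP] at h1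
  rw [hleft _ _ _ H H0 hHi hH0i, hright _ E E0 hEi hE0i Q P hcrossQ] at h2
  linear_combination -h1 - h2

/-! ### Exponential weights on the cone and their scaling in `τ`. -/

theorem norm_integral_cutoff_remainder_le {a b : R3} (ha : ‖a‖ = 1) {θ0 r0 : ℝ} (hθ0 : 0 < θ0)
    (hθ0' : θ0 < Real.pi / 2) {U V : R3 → C3} (hU : IntegrableOn U (truncCone a θ0 r0)) {r m : ℝ}
    (hV : ∀ x, ‖V x‖ ≤ m) (hV0 : ∀ x, ‖x‖ < r → V x = 0) {τ σ : ℝ} (hτ : 0 ≤ τ) :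
    ‖∫ x in truncCone a θ0 r0, cdot (U x) (cgo a b τ σ x • V x)‖ ≤
      3 * m * (∫ x in truncCone a θ0 r0, ‖U x‖) * Real.exp (-(τ * (Real.cos θ0 * r))) := by
  have hcos : 0 < Real.cos θ0 := Real.cos_pos_of_mem_Ioo ⟨by linarith, hθ0'⟩
  have hm : 0 ≤ m := (norm_nonneg _).trans (hV 0)
  rw [mul_right_comm, ← integral_const_mul]
  refine norm_integral_le_of_norm_le (hU.norm.const_mul _) ?_
  filter_upwards [ae_restrict_mem
    ((isOpen_cone ha hθ0 hθ0').inter Metric.isOpen_ball).measurableSet] with x hx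
  rcases lt_or_ge ‖x‖ r with h | h
  · rw [hV0 x h]
    simp only [cdot_eq, smul_zero, PiLp.zero_apply, mul_zero, add_zero, norm_zero]
    positivity
  · refine (norm_cdot_le _ _).trans ?_
    rw [norm_smul, norm_cgo]
    have h1 := (mem_cone_iff ha hθ0 hθ0').1 hx.1
    have h2 : Real.exp (-(τ * inner ℝ a x)) ≤ Real.exp (-(τ * (Real.cos θ0 * r))) := by
      refine Real.exp_le_exp.2 (neg_le_neg (mul_le_mul_of_nonneg_left ?_ hτ))
      exact (mul_le_mul_of_nonneg_left h hcos.le).trans h1.le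
    calc 3 * (‖U x‖ * (Real.exp (-(τ * inner ℝ a x)) * ‖V x‖))
        ≤ 3 * (‖U x‖ * (Real.exp (-(τ * (Real.cos θ0 * r))) * m)) := by gcongr; exact hV x
      _ = _ := by ring

theorem measurableSet_truncCone {a : R3} (ha : ‖a‖ = 1) {θ0 : ℝ} (hθ0 : 0 < θ0)
    (hθ0' : θ0 < Real.pi / 2) (r0 : ℝ) : MeasurableSet (truncCone a θ0 r0) :=
  ((isOpen_cone ha hθ0 hθ0').inter Metric.isOpen_ball).measurableSet

theorem smul_mem_cone_iff {a : R3} (ha : ‖a‖ = 1) {θ0 : ℝ} (hθ0 : 0 < θ0)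
    (hθ0' : θ0 < Real.pi / 2) {t : ℝ} (ht : 0 < t) {x : R3} :
    t • x ∈ cone a θ0 ↔ x ∈ cone a θ0 := by
  rw [mem_cone_iff ha hθ0 hθ0', mem_cone_iff ha hθ0 hθ0', norm_smul, Real.norm_of_nonneg ht.le,
    inner_smul_right, mul_left_comm, mul_lt_mul_iff_right₀ ht]

theorem integral_scaled {F : Type*} [NormedAddCommGroup F] [NormedSpace ℝ F] (f : R3 → F) {τ : ℝ}
    (hτ : 0 < τ) : ∫ x, f (τ⁻¹ • x) = τ ^ 3 • ∫ x, f x := by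
  rw [Measure.integral_comp_smul]
  simp [abs_of_pos hτ]

theorem norm_cgo_le {a x : R3} (b : R3) (ha : ‖a‖ = 1) {θ0 : ℝ} (hθ0 : 0 < θ0)
    (hθ0' : θ0 < Real.pi / 2) (hx : x ∈ cone a θ0) {τ : ℝ} (hτ : 0 < τ) (σ : ℝ) :
    ‖cgo a b τ σ x‖ ≤ Real.exp (-(Real.cos θ0 * ‖τ • x‖)) := by
  rw [norm_cgo, norm_smul, Real.norm_of_nonneg hτ.le, mul_left_comm]
  exact Real.exp_le_exp.2 (neg_le_neg
    (mul_le_mul_of_nonneg_left ((mem_cone_iff ha hθ0 hθ0').1 hx).le hτ.le))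

theorem tendsto_sqrt_sq_add_div (k : ℝ) :
    Tendsto (fun τ : ℝ => Real.sqrt (τ ^ 2 + k) / τ) atTop (𝓝 1) := by
  have h1 : Tendsto (fun τ : ℝ => Real.sqrt (1 + k * (τ ^ 2)⁻¹)) atTop (𝓝 (Real.sqrt (1 + k * 0))) :=
    (((tendsto_inv_atTop_zero.comp (tendsto_pow_atTop two_ne_zero)).const_mul k).const_add 1).sqrt
  simp only [mul_zero, add_zero, Real.sqrt_one] at h1
  refine h1.congr' ?_
  filter_upwards [eventually_gt_atTop 0] with τ hτ
  rw [eq_div_iff hτ.ne']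
  nth_rewrite 2 [← Real.sqrt_sq hτ.le]
  rw [← Real.sqrt_mul' _ (sq_nonneg τ)]
  congr 1
  field_simp

/-- The substitution `x ↦ x / τ` fixes the cone, flattens the cutoff to its value `1` at the apex
and replaces `σ` by `σ / τ → 1`. Dominated convergence applies with majorant `exp(-cos θ0 |x|)`. -/
theorem tendsto_integral_cutoff_cgo {a b : R3} (ha : ‖a‖ = 1) {θ0 r0 : ℝ} (hθ0 : 0 < θ0)
    (hθ0' : θ0 < Real.pi / 2) {χ : R3 → ℂ} (hχ : Continuous χ) (hχ1 : ∀ x, ‖χ x‖ ≤ 1)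
    (hχ0 : χ 0 = 1) (hχr : ∀ x, r0 ≤ ‖x‖ → χ x = 0) (k : ℝ) :
    Tendsto (fun τ : ℝ => ((τ ^ 3 : ℝ) : ℂ) *
        ∫ x in truncCone a θ0 r0, χ x * cgo a b τ (Real.sqrt (τ ^ 2 + k)) x) atTop
      (𝓝 (∫ x in cone a θ0, Complex.exp (-(((inner ℝ a x : ℝ) : ℂ) +
        Complex.I * (inner ℝ b x : ℝ))))) := by
  have hcos : 0 < Real.cos θ0 := Real.cos_pos_of_mem_Ioo ⟨by linarith, hθ0'⟩
  have hcone := (isOpen_cone ha hθ0 hθ0').measurableSet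
  let F : ℝ → R3 → ℂ := fun τ => (cone a θ0).indicator fun x =>
    χ (τ⁻¹ • x) * Complex.exp (-(((inner ℝ a x : ℝ) : ℂ) +
      Complex.I * ((Real.sqrt (τ ^ 2 + k) / τ) * inner ℝ b x : ℝ)))
  have hF : ∀ τ : ℝ, 0 < τ → ((τ ^ 3 : ℝ) : ℂ) *
      ∫ x in truncCone a θ0 r0, χ x * cgo a b τ (Real.sqrt (τ ^ 2 + k)) x = ∫ x, F τ x := by
    intro τ hτ
    have h1 : ∫ x in truncCone a θ0 r0, χ x * cgo a b τ (Real.sqrt (τ ^ 2 + k)) x =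
        ∫ x in cone a θ0, χ x * cgo a b τ (Real.sqrt (τ ^ 2 + k)) x := by
      refine (setIntegral_eq_of_subset_of_forall_sdiff_eq_zero hcone inter_subset_left ?_).symm
      rintro x ⟨hx, hx'⟩
      have : r0 ≤ ‖x‖ := by
        by_contra! h
        exact hx' ⟨hx, by simpa using h⟩
      rw [hχr x this, zero_mul]
    rw [h1, ← integral_indicator hcone, ← Complex.real_smul, ← integral_scaled _ hτ]
    refine integral_congr_ae (.of_forall fun x => ?_)
    have hmem := smul_mem_cone_iff ha hθ0 hθ0' (inv_pos.2 hτ) (x := x)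
    simp only [F]
    by_cases hx : x ∈ cone a θ0
    · rw [indicator_of_mem hx, indicator_of_mem (hmem.2 hx)]
      simp only [cgo, inner_smul_right]
      congr 5
      · field_simp
      · rw [div_mul_eq_mul_div, mul_left_comm, div_eq_inv_mul]
    · rw [indicator_of_notMem hx, indicator_of_notMem fun h => hx (hmem.1 h)]
  rw [← integral_indicator hcone]
  refine Tendsto.congr' (f₁ := fun τ => ∫ x, F τ x) ?_ ?_
  · filter_upwards [eventually_gt_atTop 0] with τ hτ using (hF τ hτ).symm
  refine tendsto_integral_filter_of_dominated_convergence
    (fun x => Real.exp (-(Real.cos θ0 * ‖x‖))) ?_ ?_ (integrable_exp_neg_mul_norm hcos) ?_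
  · refine .of_forall fun τ => (Continuous.aestronglyMeasurable ?_).indicator hcone
    exact (hχ.comp (by fun_prop)).mul (by fun_prop)
  · refine .of_forall fun τ => .of_forall fun x => ?_
    by_cases hx : x ∈ cone a θ0
    · simp only [F]
      rw [indicator_of_mem hx, norm_mul, norm_cexp_neg_add_I_mul]
      refine (mul_le_of_le_one_left (Real.exp_pos _).le (hχ1 _)).trans ?_
      exact Real.exp_le_exp.2 (neg_le_neg ((mem_cone_iff ha hθ0 hθ0').1 hx).le)
    · simp only [F]
      rw [indicator_of_notMem hx, norm_zero]
      positivity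
  · refine .of_forall fun x => ?_
    by_cases hx : x ∈ cone a θ0
    · simp only [F, indicator_of_mem hx]
      have h1 : Tendsto (fun τ : ℝ => χ (τ⁻¹ • x)) atTop (𝓝 1) := by
        rw [← hχ0]
        refine (hχ.tendsto 0).comp ?_
        simpa using (tendsto_inv_atTop_zero (𝕜 := ℝ)).smul_const x
      have h2 : Tendsto (fun τ : ℝ => Complex.exp (-(((inner ℝ a x : ℝ) : ℂ) +
          Complex.I * ((Real.sqrt (τ ^ 2 + k) / τ) * inner ℝ b x : ℝ)))) atTop
          (𝓝 (Complex.exp (-(((inner ℝ a x : ℝ) : ℂ) +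
            Complex.I * (1 * inner ℝ b x : ℝ))))) := by
        have hc : Continuous fun s : ℝ => Complex.exp (-(((inner ℝ a x : ℝ) : ℂ) +
          Complex.I * (s * inner ℝ b x : ℝ))) := by fun_prop
        exact (hc.tendsto 1).comp (tendsto_sqrt_sq_add_div k)
      simpa using h1.mul h2
    · simp only [F, indicator_of_notMem hx]
      exact tendsto_const_nhds

/-- The moments of the decaying exponential on the cone. -/
def expMoment (c : ℝ) (n : ℕ) : ℝ := ∫ x : R3, ‖x‖ ^ n * Real.exp (-(c * ‖x‖))

theorem expMoment_nonneg (c : ℝ) (n : ℕ) : 0 ≤ expMoment c n :=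
  integral_nonneg fun x => by positivity

theorem integral_norm_pow_mul_exp_neg_scaled (c : ℝ) (n : ℕ) {τ : ℝ} (hτ : 0 < τ) :
    ∫ x : R3, ‖x‖ ^ n * Real.exp (-(c * ‖τ • x‖)) = expMoment c n / τ ^ (3 + n) := by
  have h := integral_scaled (fun x : R3 => ‖x‖ ^ n * Real.exp (-(c * ‖τ • x‖))) hτ
  have h2 : ∀ x : R3, ‖τ⁻¹ • x‖ ^ n * Real.exp (-(c * ‖τ • τ⁻¹ • x‖)) =
      (τ ^ n)⁻¹ * (‖x‖ ^ n * Real.exp (-(c * ‖x‖))) := fun x => by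
    rw [smul_inv_smul₀ hτ.ne', norm_smul, norm_inv, Real.norm_of_nonneg hτ.le, mul_pow, inv_pow,
      mul_assoc]
  simp only [h2] at h
  rw [integral_const_mul, smul_eq_mul] at h
  rw [expMoment, pow_add]
  field_simp
  field_simp at h
  linarith

theorem integrable_norm_pow_mul_exp_neg_scaled {c : ℝ} (hc : 0 < c) (n : ℕ) {τ : ℝ} (hτ : 0 < τ) :
    Integrable fun x : R3 => ‖x‖ ^ n * Real.exp (-(c * ‖τ • x‖)) := by
  refine (integrable_norm_pow_mul_exp_neg (mul_pos hc hτ) n).congr (.of_forall fun x => ?_)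
  simp only [norm_smul, Real.norm_of_nonneg hτ.le, mul_assoc]

theorem setIntegral_norm_pow_mul_exp_neg_le {c : ℝ} (hc : 0 < c) (n : ℕ) (K : Set R3) {τ : ℝ}
    (hτ : 0 < τ) :
    ∫ x in K, ‖x‖ ^ n * Real.exp (-(c * ‖τ • x‖)) ≤ expMoment c n / τ ^ (3 + n) := by
  rw [← integral_norm_pow_mul_exp_neg_scaled c n hτ]
  exact setIntegral_le_integral (integrable_norm_pow_mul_exp_neg_scaled hc n hτ)
    (.of_forall fun x => by positivity)

/-- The Cauchy-Schwarz inequality with an `eLpNorm` bound on one factor. -/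
theorem integral_norm_mul_le_of_eLpNorm_le {α : Type*} [MeasurableSpace α] {ν : Measure α}
    {U : α → C3} {w : α → ℝ} {δ B : ℝ}
    (hU : AEStronglyMeasurable U ν) (hδ : 0 ≤ δ) (hUδ : eLpNorm U 2 ν ≤ ENNReal.ofReal δ)
    (hw : MemLp w 2 ν) (hw0 : ∀ x, 0 ≤ w x) (hB : ∫ x, w x ^ 2 ∂ν ≤ B) :
    ∫ x, ‖U x‖ * w x ∂ν ≤ δ * Real.sqrt B := by
  have hU2 : MemLp U 2 ν := ⟨hU, hUδ.trans_lt ENNReal.ofReal_lt_top⟩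
  have h := integral_mul_le_Lp_mul_Lq_of_nonneg (μ := ν) (f := fun x => ‖U x‖) (g := w)
    Real.HolderConjugate.two_two (.of_forall fun x => norm_nonneg _) (.of_forall hw0)
    (by simpa using hU2.norm) (by simpa using hw)
  refine h.trans (mul_le_mul ?_ ?_ (Real.rpow_nonneg
    (integral_nonneg fun x => Real.rpow_nonneg (hw0 x) _) _) hδ)
  · have h2 := hU2.eLpNorm_eq_integral_rpow_norm two_ne_zero ENNReal.ofNat_ne_top
    rw [h2, ENNReal.ofReal_le_ofReal_iff hδ] at hUδ
    simpa using hUδ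
  · rw [Real.sqrt_eq_rpow]
    refine Real.rpow_le_rpow (integral_nonneg fun x => Real.rpow_nonneg (hw0 x) _) ?_ (by norm_num)
    simpa using hB

/-! ### Approximations adapted to the scale `1 / τ`. -/

section

/-- A smooth cutoff function: `1` on the ball of radius `r`, `0` outside the ball of radius `r0`. -/
structure IsCutoff (χ : R3 → ℂ) (r r0 : ℝ) : Prop where
  contDiff : ContDiff ℝ (⊤ : ℕ∞) χ
  hasCompactSupport : HasCompactSupport χ
  norm_le_one : ∀ x, ‖χ x‖ ≤ 1
  pos : 0 < r
  eq_one : ∀ x, ‖x‖ < r → χ x = 1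
  eq_zero : ∀ x, r0 ≤ ‖x‖ → χ x = 0

/-- `G τ` is an approximation in `L²(K)` of `U` with error `δ τ = o(τ^{-3/2})` whose sup norm and
Lipschitz constant at `0` are at most `N τ = o(τ)`. -/
structure IsScaleApprox (K : Set R3) (U : R3 → C3) (G : ℝ → R3 → C3) (δ N : ℝ → ℝ) : Prop where
  memLp : MemLp U 2 (volume.restrict K)
  continuous : ∀ τ, Continuous (G τ)
  delta_nonneg : ∀ τ, 0 ≤ δ τ
  eLpNorm_sub_le : ∀ τ, 0 < τ →
    eLpNorm (fun x => U x - G τ x) 2 (volume.restrict K) ≤ ENNReal.ofReal (δ τ)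
  norm_le : ∀ τ x, ‖G τ x‖ ≤ N τ
  norm_sub_le : ∀ τ x, ‖G τ x - G τ 0‖ ≤ N τ * ‖x‖
  tendsto_delta : Tendsto (fun τ => Real.sqrt (τ ^ 3) * δ τ) atTop (𝓝 0)
  tendsto_bound : Tendsto (fun τ => N τ / τ) atTop (𝓝 0)

theorem volume_truncCone_lt_top (a : R3) (θ0 r0 : ℝ) : volume (truncCone a θ0 r0) < ⊤ :=
  (measure_mono inter_subset_right).trans_lt measure_ball_lt_top

theorem integrableOn_truncCone {a : R3} {θ0 r0 : ℝ} {U : R3 → C3}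
    (hU : MemLp U 2 (volume.restrict (truncCone a θ0 r0))) : IntegrableOn U (truncCone a θ0 r0) := by
  have : IsFiniteMeasure (volume.restrict (truncCone a θ0 r0)) :=
    ⟨by simpa using volume_truncCone_lt_top a θ0 r0⟩
  exact hU.integrable one_le_two

/-- The weight `exp (-c |τ x|)`. -/
def expWeight (c τ : ℝ) (x : R3) : ℝ := Real.exp (-(c * ‖τ • x‖))

theorem expWeight_pos (c τ : ℝ) (x : R3) : 0 < expWeight c τ x := Real.exp_pos _

theorem expWeight_le_one {c : ℝ} (hc : 0 < c) (τ : ℝ) (x : R3) : expWeight c τ x ≤ 1 :=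
  Real.exp_le_one_iff.2 (neg_nonpos.2 (by positivity))

theorem continuous_expWeight (c τ : ℝ) : Continuous (expWeight c τ) := by
  unfold expWeight; fun_prop

theorem integrableOn_norm_mul_expWeight {K : Set R3} {U : R3 → C3} (hU : IntegrableOn U K) {c : ℝ}
    (hc : 0 < c) (τ : ℝ) : IntegrableOn (fun x => ‖U x‖ * expWeight c τ x) K := by
  have h : Integrable (fun x => ‖U x‖) (volume.restrict K) := Integrable.norm hU
  refine h.mono' (h.aestronglyMeasurable.mul (continuous_expWeight c τ).aestronglyMeasurable)
    (.of_forall fun x => ?_)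
  rw [norm_mul, norm_norm, Real.norm_of_nonneg (expWeight_pos _ _ _).le]
  exact mul_le_of_le_one_right (norm_nonneg _) (expWeight_le_one hc τ x)

theorem setIntegral_expWeight_le {c : ℝ} (hc : 0 < c) (K : Set R3) {τ : ℝ} (hτ : 0 < τ) :
    ∫ x in K, expWeight c τ x ≤ expMoment c 0 / τ ^ 3 := by
  simpa [expWeight] using setIntegral_norm_pow_mul_exp_neg_le hc 0 K hτ

theorem setIntegral_norm_mul_expWeight_le {c : ℝ} (hc : 0 < c) (K : Set R3) {τ : ℝ} (hτ : 0 < τ) :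
    ∫ x in K, ‖x‖ * expWeight c τ x ≤ expMoment c 1 / τ ^ 4 := by
  simpa [expWeight] using setIntegral_norm_pow_mul_exp_neg_le hc 1 K hτ

theorem integrable_expWeight {c : ℝ} (hc : 0 < c) {τ : ℝ} (hτ : 0 < τ) :
    Integrable (expWeight c τ) := by
  change Integrable fun x : R3 => Real.exp (-(c * ‖τ • x‖))
  simpa using integrable_norm_pow_mul_exp_neg_scaled hc 0 hτ

theorem memLp_expWeight {c : ℝ} (hc : 0 < c) (K : Set R3) {τ : ℝ} (hτ : 0 < τ) :
    MemLp (expWeight c τ) 2 (volume.restrict K) := by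
  rw [memLp_two_iff_integrable_sq (continuous_expWeight c τ).aestronglyMeasurable]
  refine ((integrable_expWeight hc hτ).mono' ((continuous_expWeight c τ).pow 2).aestronglyMeasurable
    (.of_forall fun x => ?_)).integrableOn
  rw [Pi.pow_apply, norm_pow, Real.norm_of_nonneg (expWeight_pos _ _ _).le, pow_two]
  exact mul_le_of_le_one_right (expWeight_pos _ _ _).le (expWeight_le_one hc τ x)

variable {a : R3} {θ0 r0 : ℝ} {U : R3 → C3} {G : ℝ → R3 → C3} {δ N : ℝ → ℝ}

theorem IsScaleApprox.bound_nonneg {K : Set R3} (h : IsScaleApprox K U G δ N) (τ : ℝ) : 0 ≤ N τ :=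
  (norm_nonneg _).trans (h.norm_le τ 0)

theorem IsScaleApprox.integrableOn (h : IsScaleApprox (truncCone a θ0 r0) U G δ N) :
    IntegrableOn U (truncCone a θ0 r0) := integrableOn_truncCone h.memLp

theorem IsScaleApprox.integrableOn_approx (h : IsScaleApprox (truncCone a θ0 r0) U G δ N) (τ : ℝ) :
    IntegrableOn (G τ) (truncCone a θ0 r0) := by
  have hc : IntegrableOn (fun _ : R3 => N τ) (truncCone a θ0 r0) :=
    integrableOn_const (volume_truncCone_lt_top a θ0 r0).ne
  exact Integrable.mono' hc (h.continuous τ).aestronglyMeasurable (.of_forall (h.norm_le τ))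

/-- By Cauchy-Schwarz: the weight has `L²` norm of order `τ^(-3/2)`, and the error `δ τ` is
`o(τ^(-3/2))`. -/
theorem IsScaleApprox.tendsto_sub (h : IsScaleApprox (truncCone a θ0 r0) U G δ N) {c : ℝ}
    (hc : 0 < c) :
    Tendsto (fun τ : ℝ => τ ^ 3 * ∫ x in truncCone a θ0 r0, ‖U x - G τ x‖ * expWeight c τ x)
      atTop (𝓝 0) := by
  have hlim := h.tendsto_delta.const_mul (Real.sqrt (expMoment c 0))
  rw [mul_zero] at hlim
  refine squeeze_zero' ?_ ?_ hlim
  · filter_upwards [eventually_gt_atTop 0] with τ hτ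
    exact mul_nonneg (by positivity) (integral_nonneg fun x =>
      mul_nonneg (norm_nonneg _) (expWeight_pos _ _ _).le)
  · filter_upwards [eventually_gt_atTop 0] with τ hτ
    have hB : ∫ x in truncCone a θ0 r0, expWeight c τ x ^ 2 ≤ expMoment c 0 / τ ^ 3 := by
      refine le_trans (integral_mono_of_nonneg (.of_forall fun x => sq_nonneg _)
        (integrable_expWeight hc hτ).integrableOn (.of_forall fun x => ?_))
        (setIntegral_expWeight_le hc _ hτ)
      simp only [pow_two]
      exact mul_le_of_le_one_right (expWeight_pos _ _ _).le (expWeight_le_one hc τ x)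
    have hm : AEStronglyMeasurable (fun x => U x - G τ x)
        (volume.restrict (truncCone a θ0 r0)) :=
      h.memLp.aestronglyMeasurable.sub (h.continuous τ).aestronglyMeasurable
    have h1 := integral_norm_mul_le_of_eLpNorm_le hm (h.delta_nonneg τ) (h.eLpNorm_sub_le τ hτ)
      (memLp_expWeight hc _ hτ) (fun x => (expWeight_pos _ _ _).le) hB
    refine (mul_le_mul_of_nonneg_left h1 (by positivity)).trans (le_of_eq ?_)
    have h3 : 0 < τ ^ 3 := by positivity
    rw [Real.sqrt_div (expMoment_nonneg c 0)]
    have h4 : Real.sqrt (τ ^ 3) ≠ 0 := (Real.sqrt_pos.2 h3).ne'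
    nth_rewrite 1 [← Real.sq_sqrt h3.le]
    field_simp

/-- The Lipschitz bound brings in the first moment of the weight, of order `τ^(-4)`, against a
constant `N τ = o(τ)`. -/
theorem IsScaleApprox.tendsto_sub_const (h : IsScaleApprox (truncCone a θ0 r0) U G δ N) {c : ℝ}
    (hc : 0 < c) :
    Tendsto (fun τ : ℝ => τ ^ 3 *
      ∫ x in truncCone a θ0 r0, ‖G τ x - G τ 0‖ * expWeight c τ x) atTop (𝓝 0) := by
  have hlim := h.tendsto_bound.const_mul (expMoment c 1)
  rw [mul_zero] at hlim
  refine squeeze_zero' ?_ ?_ hlim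
  · filter_upwards [eventually_gt_atTop 0] with τ hτ
    exact mul_nonneg (by positivity) (integral_nonneg fun x =>
      mul_nonneg (norm_nonneg _) (expWeight_pos _ _ _).le)
  · filter_upwards [eventually_gt_atTop 0] with τ hτ
    have hi : Integrable fun x : R3 => N τ * (‖x‖ * expWeight c τ x) := by
      have := (integrable_norm_pow_mul_exp_neg_scaled hc 1 hτ).const_mul (N τ)
      simpa [expWeight] using this
    have h1 : ∫ x in truncCone a θ0 r0, ‖G τ x - G τ 0‖ * expWeight c τ x ≤
        ∫ x in truncCone a θ0 r0, N τ * (‖x‖ * expWeight c τ x) := by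
      refine integral_mono_of_nonneg (.of_forall fun x =>
        mul_nonneg (norm_nonneg _) (expWeight_pos _ _ _).le) hi.integrableOn (.of_forall fun x => ?_)
      simp only [← mul_assoc]
      exact mul_le_mul_of_nonneg_right (h.norm_sub_le τ x) (expWeight_pos _ _ _).le
    rw [integral_const_mul] at h1
    have h2 := h1.trans (mul_le_mul_of_nonneg_left
      (setIntegral_norm_mul_expWeight_le hc (truncCone a θ0 r0) hτ) (h.bound_nonneg τ))
    refine (mul_le_mul_of_nonneg_left h2 (by positivity)).trans (le_of_eq ?_)
    field_simp

/-- This disposes of the magnetic term. The field itself need not be bounded near the apex; its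
approximations have sup norm `o(τ)`, which the extra factor `τ⁻¹` absorbs. -/
theorem IsScaleApprox.tendsto_inv_mul (h : IsScaleApprox (truncCone a θ0 r0) U G δ N) {c : ℝ}
    (hc : 0 < c) :
    Tendsto (fun τ : ℝ => τ ^ 3 * (τ⁻¹ * ∫ x in truncCone a θ0 r0, ‖U x‖ * expWeight c τ x))
      atTop (𝓝 0) := by
  have hlim := (h.tendsto_sub hc).add (h.tendsto_bound.const_mul (expMoment c 0))
  rw [mul_zero, add_zero] at hlim
  refine squeeze_zero' ?_ ?_ hlim
  · filter_upwards [eventually_gt_atTop 0] with τ hτ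
    exact mul_nonneg (by positivity) (mul_nonneg (by positivity) (integral_nonneg fun x =>
      mul_nonneg (norm_nonneg _) (expWeight_pos _ _ _).le))
  · filter_upwards [eventually_ge_atTop 1] with τ hτ1
    have hτ : 0 < τ := by linarith
    have hUG : IntegrableOn (fun x => U x - G τ x) (truncCone a θ0 r0) :=
      h.integrableOn.sub (h.integrableOn_approx τ)
    have hi1 := integrableOn_norm_mul_expWeight hUG hc τ
    have hi2 : IntegrableOn (fun x => N τ * expWeight c τ x) (truncCone a θ0 r0) :=
      ((integrable_expWeight hc hτ).const_mul (N τ)).integrableOn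
    have h1 : ∫ x in truncCone a θ0 r0, ‖U x‖ * expWeight c τ x ≤
        ∫ x in truncCone a θ0 r0, (‖U x - G τ x‖ * expWeight c τ x + N τ * expWeight c τ x) := by
      refine integral_mono_of_nonneg (.of_forall fun x =>
        mul_nonneg (norm_nonneg _) (expWeight_pos _ _ _).le) (hi1.add hi2) (.of_forall fun x => ?_)
      simp only [← add_mul]
      refine mul_le_mul_of_nonneg_right ?_ (expWeight_pos _ _ _).le
      have := norm_add_le (U x - G τ x) (G τ x)
      rw [sub_add_cancel] at this
      linarith [h.norm_le τ x]
    rw [integral_add hi1 hi2, integral_const_mul] at h1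
    set I := ∫ x in truncCone a θ0 r0, ‖U x - G τ x‖ * expWeight c τ x with hI
    have hI0 : 0 ≤ I := integral_nonneg fun x =>
      mul_nonneg (norm_nonneg _) (expWeight_pos _ _ _).le
    have h2 := h1.trans (add_le_add_right (mul_le_mul_of_nonneg_left
      (setIntegral_expWeight_le hc (truncCone a θ0 r0) hτ) (h.bound_nonneg τ)) I)
    calc τ ^ 3 * (τ⁻¹ * ∫ x in truncCone a θ0 r0, ‖U x‖ * expWeight c τ x)
        ≤ τ ^ 3 * (τ⁻¹ * (I + N τ * (expMoment c 0 / τ ^ 3))) := by gcongr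
      _ = τ⁻¹ * (τ ^ 3 * I) + expMoment c 0 * (N τ / τ) := by field_simp
      _ ≤ τ ^ 3 * I + expMoment c 0 * (N τ / τ) :=
        add_le_add (mul_le_of_le_one_left (by positivity) (inv_le_one_of_one_le₀ hτ1)) le_rfl

theorem norm_integral_cutoff_cgo_le (ha : ‖a‖ = 1) (hθ0 : 0 < θ0) (hθ0' : θ0 < Real.pi / 2)
    {χ : R3 → ℂ} (hχ1 : ∀ x, ‖χ x‖ ≤ 1) (hU : IntegrableOn U (truncCone a θ0 r0)) (b : R3) (V : C3)
    {τ : ℝ} (hτ : 0 < τ) (σ : ℝ) :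
    ‖∫ x in truncCone a θ0 r0, cdot (U x) ((χ x * cgo a b τ σ x) • V)‖ ≤
      3 * ‖V‖ * ∫ x in truncCone a θ0 r0, ‖U x‖ * expWeight (Real.cos θ0) τ x := by
  have hcos : 0 < Real.cos θ0 := Real.cos_pos_of_mem_Ioo ⟨by linarith, hθ0'⟩
  rw [← integral_const_mul]
  refine norm_integral_le_of_norm_le
    ((integrableOn_norm_mul_expWeight hU hcos τ).const_mul _) ?_
  filter_upwards [ae_restrict_mem (measurableSet_truncCone ha hθ0 hθ0' r0)] with x hx
  refine (norm_cdot_le _ _).trans ?_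
  have h1 : ‖χ x * cgo a b τ σ x‖ ≤ expWeight (Real.cos θ0) τ x := by
    rw [norm_mul]
    exact (mul_le_of_le_one_left (norm_nonneg _) (hχ1 x)).trans
      (norm_cgo_le b ha hθ0 hθ0' hx.1 hτ σ)
  rw [norm_smul]
  calc 3 * (‖U x‖ * (‖χ x * cgo a b τ σ x‖ * ‖V‖))
      ≤ 3 * (‖U x‖ * (expWeight (Real.cos θ0) τ x * ‖V‖)) := by gcongr
    _ = _ := by ring

end

/-! ### The limit of the tested identity as `τ → ∞`. -/

section

theorem tendsto_pow_mul_exp_neg_mul {κ : ℝ} (hκ : 0 < κ) (n : ℕ) :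
    Tendsto (fun τ : ℝ => τ ^ n * Real.exp (-(τ * κ))) atTop (𝓝 0) := by
  have h1 : Tendsto (fun τ : ℝ => τ * κ) atTop atTop := tendsto_id.atTop_mul_const hκ
  have h2 := ((Real.tendsto_pow_mul_exp_neg_atTop_nhds_zero n).comp h1).const_mul ((κ ^ n)⁻¹)
  rw [mul_zero] at h2
  refine h2.congr fun τ => ?_
  simp only [Function.comp_apply, mul_pow]
  field_simp

theorem IsCutoff.grad_eq_zero {χ : R3 → ℂ} {r r0 : ℝ} (h : IsCutoff χ r r0) {x : R3}
    (hx : ‖x‖ < r) : grad χ x = 0 := by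
  have h1 : χ =ᶠ[𝓝 x] fun _ => 1 := by
    filter_upwards [Metric.isOpen_ball.mem_nhds (show x ∈ Metric.ball (0 : R3) r by simpa using hx)]
      with y hy
    exact h.eq_one y (by simpa using hy)
  rw [C3.ext_iff]
  simp [h1.fderiv_eq]

theorem IsCutoff.exists_norm_grad_le {χ : R3 → ℂ} {r r0 : ℝ} (h : IsCutoff χ r r0) :
    ∃ M, ∀ x, ‖grad χ x‖ ≤ M :=
  (hasCompactSupport_grad h.hasCompactSupport).exists_bound_of_continuous
    (continuous_grad h.contDiff)

variable {a b : R3} {θ0 r0 r : ℝ} {χ : R3 → ℂ}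

theorem norm_elecPol_le (ha : ‖a‖ = 1) (hb : ‖b‖ = 1) (τ σ : ℝ) :
    ‖elecPol a b τ σ‖ ≤ |σ / τ| + 1 := by
  refine (norm_add_le _ _).trans (le_of_eq ?_)
  rw [norm_smul, norm_smul, norm_toC3, norm_toC3, ha, hb, Complex.norm_real, Complex.norm_I,
    Real.norm_eq_abs]
  ring

theorem norm_magPol_le (ha : ‖a‖ = 1) (hb : ‖b‖ = 1) (s : ℝ) : ‖magPol a b s‖ ≤ 6 * |s| := by
  rw [magPol, norm_smul, Complex.norm_real, Real.norm_eq_abs]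
  have := norm_cross_le (toC3 a) (toC3 b)
  rw [norm_toC3, norm_toC3, ha, hb] at this
  nlinarith [abs_nonneg s]

theorem tendsto_cutoff_remainder (ha : ‖a‖ = 1) (hθ0 : 0 < θ0) (hθ0' : θ0 < Real.pi / 2)
    (hχ : IsCutoff χ r r0) {U : R3 → C3} (hU : IntegrableOn U (truncCone a θ0 r0))
    {V : ℝ → C3} {σ : ℝ → ℝ} {m : ℝ} (hV : ∀ᶠ τ in atTop, ‖V τ‖ ≤ m) :
    Tendsto (fun τ : ℝ => ((τ ^ 3 : ℝ) : ℂ) * ∫ x in truncCone a θ0 r0,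
      cdot (U x) (cgo a b τ (σ τ) x • cross (grad χ x) (V τ))) atTop (𝓝 0) := by
  have hcos : 0 < Real.cos θ0 := Real.cos_pos_of_mem_Ioo ⟨by linarith, hθ0'⟩
  obtain ⟨M, hM⟩ := hχ.exists_norm_grad_le
  have hM0 : 0 ≤ M := (norm_nonneg _).trans (hM 0)
  have hlim := (tendsto_pow_mul_exp_neg_mul (mul_pos hcos hχ.pos) 3).const_mul
    (3 * (6 * (M * m)) * ∫ x in truncCone a θ0 r0, ‖U x‖)
  rw [mul_zero] at hlim
  refine squeeze_zero_norm' ?_ hlim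
  filter_upwards [hV, eventually_ge_atTop 0] with τ hVτ hτ
  rw [norm_mul, Complex.norm_real, Real.norm_of_nonneg (by positivity)]
  have h1 := norm_integral_cutoff_remainder_le (b := b) ha hθ0 hθ0' hU (r := r)
    (V := fun x => cross (grad χ x) (V τ)) (m := 6 * (M * m)) (τ := τ) (σ := σ τ)
    (fun x => (norm_cross_le _ _).trans (by gcongr; exact hM x))
    (fun x hx => by rw [hχ.grad_eq_zero hx, C3.ext_iff]; simp) hτ
  refine (mul_le_mul_of_nonneg_left h1 (by positivity)).trans (le_of_eq ?_)
  ring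

/-- The function `s` records the size of the polarization: `1` for the electric one and `τ⁻¹` for
the magnetic one. -/
theorem tendsto_integral_cutoff_cgo_of_weight (ha : ‖a‖ = 1) (hθ0 : 0 < θ0)
    (hθ0' : θ0 < Real.pi / 2) (hχ1 : ∀ x, ‖χ x‖ ≤ 1) (b : R3) (σ : ℝ → ℝ) {W : ℝ → R3 → C3}
    {V : ℝ → C3} {s : ℝ → ℝ} {m : ℝ} (hW : ∀ τ, IntegrableOn (W τ) (truncCone a θ0 r0))
    (hV : ∀ᶠ τ in atTop, ‖V τ‖ ≤ m * s τ)
    (hlim : Tendsto (fun τ : ℝ => τ ^ 3 * (s τ *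
      ∫ x in truncCone a θ0 r0, ‖W τ x‖ * expWeight (Real.cos θ0) τ x)) atTop (𝓝 0)) :
    Tendsto (fun τ : ℝ => ((τ ^ 3 : ℝ) : ℂ) *
      ∫ x in truncCone a θ0 r0, cdot (W τ x) ((χ x * cgo a b τ (σ τ) x) • V τ)) atTop (𝓝 0) := by
  have hlim' := hlim.const_mul (3 * m)
  rw [mul_zero] at hlim'
  refine squeeze_zero_norm' ?_ hlim'
  filter_upwards [hV, eventually_gt_atTop 0] with τ hVτ hτ
  rw [norm_mul, Complex.norm_real, Real.norm_of_nonneg (by positivity)]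
  have h1 := norm_integral_cutoff_cgo_le ha hθ0 hθ0' hχ1 (hW τ) b (V τ) hτ (σ τ)
  have hI : 0 ≤ ∫ x in truncCone a θ0 r0, ‖W τ x‖ * expWeight (Real.cos θ0) τ x :=
    integral_nonneg fun x => mul_nonneg (norm_nonneg _) (expWeight_pos _ _ _).le
  have h2 := mul_le_mul_of_nonneg_right (mul_le_mul_of_nonneg_left hVτ (zero_le_three (α := ℝ))) hI
  have h3 := mul_le_mul_of_nonneg_left (h1.trans h2) (pow_nonneg hτ.le 3)
  refine h3.trans (le_of_eq ?_)
  ring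

theorem eventually_norm_elecPol_le (ha : ‖a‖ = 1) (hb : ‖b‖ = 1) {σ : ℝ → ℝ}
    (hσ : Tendsto (fun τ => σ τ / τ) atTop (𝓝 1)) :
    ∀ᶠ τ in atTop, ‖elecPol a b τ (σ τ)‖ ≤ 3 * 1 := by
  have h := hσ.abs
  rw [abs_one] at h
  filter_upwards [h.eventually_le_const one_lt_two] with τ h1
  linarith [norm_elecPol_le ha hb τ (σ τ)]

theorem eventually_norm_magPol_le (ha : ‖a‖ = 1) (hb : ‖b‖ = 1) {s : ℝ} (hs : 0 ≤ s) :
    ∀ᶠ τ : ℝ in atTop, ‖magPol a b (s / τ)‖ ≤ 6 * s * τ⁻¹ := by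
  filter_upwards [eventually_gt_atTop 0] with τ hτ
  refine (norm_magPol_le ha hb _).trans (le_of_eq ?_)
  rw [abs_of_nonneg (by positivity)]
  ring

/-- Integrability of `E`, `E0` and `H0` suffices, as on the right-hand side they meet only `grad χ`;
a scale approximation is needed for `H` alone. -/
theorem tendsto_integral_elecPol (ha : ‖a‖ = 1) (hb : ‖b‖ = 1) (hab : inner ℝ a b = 0)
    (hθ0 : 0 < θ0) (hθ0' : θ0 < Real.pi / 2) (hχ : IsCutoff χ r r0)
    {E H E0 H0 : R3 → C3} {G' : ℝ → R3 → C3} {δ' N' : ℝ → ℝ}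
    (hEi : IntegrableOn E (truncCone a θ0 r0))
    (hHG : IsScaleApprox (truncCone a θ0 r0) H G' δ' N')
    (hE0i : IntegrableOn E0 (truncCone a θ0 r0)) (hH0i : IntegrableOn H0 (truncCone a θ0 r0))
    {ω μ γ μ0 ε0 : ℝ} (hω : 0 < ω) (hε0 : 0 < ε0)
    (hE : ∀ φ : R3 → C3, ContDiff ℝ (⊤ : ℕ∞) φ → tsupport φ ⊆ tsupport χ →
      ∫ x in truncCone a θ0 r0, cdot ((Complex.I * ω) • ((μ : ℂ) • H x - (μ0 : ℂ) • H0 x)) (φ x) =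
        ∫ x in truncCone a θ0 r0, cdot (E x - E0 x) (curl φ x))
    (hH : ∀ φ : R3 → C3, ContDiff ℝ (⊤ : ℕ∞) φ → tsupport φ ⊆ tsupport χ →
      ∫ x in truncCone a θ0 r0,
        cdot ((-(Complex.I * ω)) • ((γ : ℂ) • E x - (ε0 : ℂ) • E0 x)) (φ x) =
        ∫ x in truncCone a θ0 r0, cdot (H x - H0 x) (curl φ x))
    (hγ : γ ≠ ε0) {σ : ℝ → ℝ} (hσ : ∀ τ, σ τ ^ 2 = τ ^ 2 + ω ^ 2 * ε0 * μ0)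
    (hσ' : Tendsto (fun τ => σ τ / τ) atTop (𝓝 1)) :
    Tendsto (fun τ : ℝ => ((τ ^ 3 : ℝ) : ℂ) * ∫ x in truncCone a θ0 r0,
      cdot (E x) ((χ x * cgo a b τ (σ τ) x) • elecPol a b τ (σ τ))) atTop (𝓝 0) := by
  have hcos : 0 < Real.cos θ0 := Real.cos_pos_of_mem_Ioo ⟨by linarith, hθ0'⟩
  have hHi := hHG.integrableOn
  have hP := eventually_norm_elecPol_le ha hb hσ'
  have hQ := eventually_norm_magPol_le ha hb (mul_nonneg hω.le hε0.le)
  have hQ1 : ∀ᶠ τ : ℝ in atTop, ‖magPol a b (ω * ε0 / τ)‖ ≤ 6 * (ω * ε0) := by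
    filter_upwards [hQ, eventually_ge_atTop 1] with τ h hτ
    exact h.trans (mul_le_of_le_one_right (by positivity) (inv_le_one_of_one_le₀ hτ))
  have hB := tendsto_integral_cutoff_cgo_of_weight ha hθ0 hθ0' hχ.norm_le_one b σ
    (W := fun _ => H) (fun _ => hHi) hQ (hHG.tendsto_inv_mul hcos)
  have hHH : IntegrableOn (fun x => H x - H0 x) (truncCone a θ0 r0) := hHi.sub hH0i
  have hEE : IntegrableOn (fun x => E x - E0 x) (truncCone a θ0 r0) := hEi.sub hE0i
  have hR1 := tendsto_cutoff_remainder (b := b) (σ := σ) ha hθ0 hθ0' hχ hHH hP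
  have hR2 := tendsto_cutoff_remainder (b := b) (σ := σ) ha hθ0 hθ0' hχ hEE hQ1
  have hsum := (((hB.const_mul (Complex.I * ω * (μ - μ0))).sub hR1).sub hR2).const_mul
    ((Complex.I * ω * (γ - ε0))⁻¹)
  simp only [mul_zero, sub_zero] at hsum
  refine hsum.congr' ?_
  filter_upwards [eventually_gt_atTop 0] with τ hτ
  have hid := cutoff_cgo_identity ha hb hab hχ.contDiff hχ.hasCompactSupport hEi hHi hE0i hH0i
    hE hH hτ (hσ τ)
  have hc0 : Complex.I * ω * (γ - ε0) ≠ 0 :=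
    mul_ne_zero (mul_ne_zero Complex.I_ne_zero (by exact_mod_cast hω.ne'))
      (sub_ne_zero.2 (by exact_mod_cast hγ))
  rw [inv_mul_eq_iff_eq_mul₀ hc0]
  linear_combination (-((τ ^ 3 : ℝ) : ℂ)) * hid

/-- Split `E = (E - G) + (G - G(0)) + G(0)`. The first two parts are negligible after multiplication
by `τ ^ 3`, and the constant part factors out of the integral of `χ e`, whose rescaled limit is
nonzero. -/
theorem tendsto_cdot_elecPol (ha : ‖a‖ = 1) (hb : ‖b‖ = 1) (hab : inner ℝ a b = 0)
    (hθ0 : 0 < θ0) (hθ0' : θ0 < Real.pi / 2) (hχ : IsCutoff χ r r0)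
    {E : R3 → C3} {G : ℝ → R3 → C3} {δ N : ℝ → ℝ}
    (hEG : IsScaleApprox (truncCone a θ0 r0) E G δ N) (k : ℝ)
    (hX : Tendsto (fun τ : ℝ => ((τ ^ 3 : ℝ) : ℂ) * ∫ x in truncCone a θ0 r0,
      cdot (E x) ((χ x * cgo a b τ (Real.sqrt (τ ^ 2 + k)) x) •
        elecPol a b τ (Real.sqrt (τ ^ 2 + k)))) atTop (𝓝 0)) :
    Tendsto (fun τ : ℝ => cdot (G τ 0) (elecPol a b τ (Real.sqrt (τ ^ 2 + k)))) atTop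
      (𝓝 0) := by
  have hcos : 0 < Real.cos θ0 := Real.cos_pos_of_mem_Ioo ⟨by linarith, hθ0'⟩
  have hEi := hEG.integrableOn
  have hP := eventually_norm_elecPol_le ha hb (tendsto_sqrt_sq_add_div k)
  have hGc : ∀ τ, IntegrableOn (fun _ : R3 => G τ 0) (truncCone a θ0 r0) := fun τ =>
    integrableOn_const (volume_truncCone_lt_top a θ0 r0).ne
  have hi1 : ∀ τ, IntegrableOn (fun x => E x - G τ x) (truncCone a θ0 r0) := fun τ =>
    hEi.sub (hEG.integrableOn_approx τ)
  have hi2 : ∀ τ, IntegrableOn (fun x => G τ x - G τ 0) (truncCone a θ0 r0) := fun τ =>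
    (hEG.integrableOn_approx τ).sub (hGc τ)
  have hD := tendsto_integral_cutoff_cgo_of_weight ha hθ0 hθ0' hχ.norm_le_one b
    (fun τ => Real.sqrt (τ ^ 2 + k)) (s := fun _ => 1) hi1 hP (by simpa using hEG.tendsto_sub hcos)
  have hL := tendsto_integral_cutoff_cgo_of_weight ha hθ0 hθ0' hχ.norm_le_one b
    (fun τ => Real.sqrt (τ ^ 2 + k)) (s := fun _ => 1) hi2 hP (by simpa using hEG.tendsto_sub_const hcos)
  have hχr := tendsto_integral_cutoff_cgo (b := b) ha hθ0 hθ0' hχ.contDiff.continuous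
    hχ.norm_le_one (hχ.eq_one 0 (by simpa using hχ.pos)) hχ.eq_zero k
  have hne := integral_cone_cexp_ne_zero ha hb hab hθ0 hθ0'
  have hJP := ((hX.sub hD).sub hL).div hχr hne
  rw [sub_zero, sub_zero, zero_div] at hJP
  refine hJP.congr' ?_
  filter_upwards [hχr.eventually_ne hne] with τ hJ
  rw [Pi.div_apply, div_eq_iff hJ]
  set σ := Real.sqrt (τ ^ 2 + k)
  set P := elecPol a b τ σ
  have hcont : Continuous fun x => (χ x * cgo a b τ σ x) • P :=
    (hχ.contDiff.continuous.mul (contDiff_cgo a b τ σ).continuous).smul continuous_const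
  have hcs : HasCompactSupport fun x => (χ x * cgo a b τ σ x) • P :=
    hχ.hasCompactSupport.mono fun x hx hx' => hx (by simp only [hx', zero_mul, zero_smul])
  have hiE := integrableOn_cdot hEi hcont hcs
  have hiG := integrableOn_cdot (hEG.integrableOn_approx τ) hcont hcs
  have hiC := integrableOn_cdot (hGc τ) hcont hcs
  simp only [sub_cdot]
  rw [integral_sub hiE hiG, integral_sub hiG hiC]
  simp only [cdot_smul]
  rw [integral_mul_const]
  ring

end

/-! ### From the polarizations to the value at the apex, and from there to averages. -/

section

theorem cdot_neg (u v : C3) : cdot u (-v) = -cdot u v := by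
  simp [cdot_eq]; ring

theorem neg_cdot (u v : C3) : cdot (-u) v = -cdot u v := by
  simp [cdot_eq]; ring

theorem toC3_neg (v : R3) : toC3 (-v) = -toC3 v := by
  rw [C3.ext_iff]; simp

theorem exists_orthonormalBasis_zero_eq {a : R3} (ha : ‖a‖ = 1) :
    ∃ B : OrthonormalBasis (Fin 3) ℝ R3, B 0 = a := by
  have hon : Orthonormal ℝ (({0} : Set (Fin 3)).domRestrict fun _ => a) := by
    rw [orthonormal_iff_ite]
    rintro ⟨i, hi⟩ ⟨j, hj⟩
    simp only [mem_singleton_iff] at hi hj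
    subst hi; subst hj
    simp [domRestrict, ha]
  obtain ⟨B, hB⟩ := hon.exists_orthonormalBasis_extension_of_card_eq (by simp)
  exact ⟨B, hB 0 (by simp)⟩

theorem apply_eq_sum_cdot (B : OrthonormalBasis (Fin 3) ℝ R3) (u : C3) (i : Fin 3) :
    u i = ∑ n, (B n i : ℂ) * cdot u (toC3 (B n)) := by
  have h : ∀ j, (EuclideanSpace.single i (1 : ℝ) : R3) j = ∑ n, B n i * B n j := fun j => by
    have h1 := B.sum_repr' (EuclideanSpace.single i (1 : ℝ))
    have h2 := congrArg (fun v : R3 => v j) h1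
    simp only [EuclideanSpace.inner_single_right] at h2
    simpa using h2.symm
  have h' : ∀ j, (((EuclideanSpace.single i (1 : ℝ) : R3) j : ℝ) : ℂ) =
      ∑ n, (B n i : ℂ) * (B n j : ℂ) := fun j => by
    rw [h]; push_cast; rfl
  have h3 : u i = ∑ j, u j * (((EuclideanSpace.single i (1 : ℝ) : R3) j : ℝ) : ℂ) := by
    fin_cases i <;> simp [Fin.sum_univ_three]
  rw [h3]
  simp only [h', cdot, toC3_apply, Finset.mul_sum]
  rw [Finset.sum_comm]
  refine Finset.sum_congr rfl fun n _ => Finset.sum_congr rfl fun j _ => ?_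
  ring

/-- The polarizations for `b` and `-b` have difference `2 i b` and sum `2 (σ / τ) a`, so the
hypothesis controls the components along the axis and along every direction orthogonal to it. -/
theorem tendsto_zero_of_cdot_elecPol {a : R3} (ha : ‖a‖ = 1) {σ : ℝ → ℝ}
    (hσ : Tendsto (fun τ => σ τ / τ) atTop (𝓝 1)) {v : ℝ → C3}
    (h : ∀ b : R3, ‖b‖ = 1 → inner ℝ a b = 0 →
      Tendsto (fun τ => cdot (v τ) (elecPol a b τ (σ τ))) atTop (𝓝 0)) :
    Tendsto v atTop (𝓝 0) := by
  obtain ⟨B, hB⟩ := exists_orthonormalBasis_zero_eq ha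
  have hneg : ∀ b : R3, ‖b‖ = 1 → inner ℝ a b = 0 →
      Tendsto (fun τ => cdot (v τ) (elecPol a (-b) τ (σ τ))) atTop (𝓝 0) := fun b hb hab =>
    h (-b) (by simpa using hb) (by simpa using hab)
  have hperp : ∀ b : R3, ‖b‖ = 1 → inner ℝ a b = 0 →
      Tendsto (fun τ => cdot (v τ) (toC3 b)) atTop (𝓝 0) := fun b hb hab => by
    have h1 := ((h b hb hab).sub (hneg b hb hab)).const_mul ((2 * Complex.I)⁻¹)
    rw [sub_zero, mul_zero] at h1
    refine h1.congr fun τ => ?_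
    simp only [elecPol, toC3_neg, cdot_add, cdot_smul, cdot_neg]
    field_simp
    ring
  have haxis : Tendsto (fun τ => cdot (v τ) (toC3 a)) atTop (𝓝 0) := by
    have hb : ‖B 1‖ = 1 := B.orthonormal.1 1
    have hab : inner ℝ a (B 1) = 0 := by
      rw [← hB]; exact B.orthonormal.2 (by decide)
    have hσc : Tendsto (fun τ => 2 * ((σ τ / τ : ℝ) : ℂ)) atTop (𝓝 (2 * ((1 : ℝ) : ℂ))) :=
      ((Complex.continuous_ofReal.tendsto 1).comp hσ).const_mul 2
    have hne : (2 * ((1 : ℝ) : ℂ)) ≠ 0 := by simp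
    have h1 := ((h (B 1) hb hab).add (hneg (B 1) hb hab)).div hσc hne
    rw [add_zero, zero_div] at h1
    refine h1.congr' ?_
    filter_upwards [hσc.eventually_ne hne] with τ hτ
    rw [Pi.div_apply, div_eq_iff hτ]
    simp only [elecPol, toC3_neg, cdot_add, cdot_smul, cdot_neg]
    ring
  have hall : ∀ n, Tendsto (fun τ => cdot (v τ) (toC3 (B n))) atTop (𝓝 0) := fun n => by
    by_cases hn : n = 0
    · rw [hn, hB]; exact haxis
    · exact hperp _ (B.orthonormal.1 n) (by rw [← hB]; exact B.orthonormal.2 (Ne.symm hn))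
  have hcomp : ∀ i, Tendsto (fun τ => v τ i) atTop (𝓝 0) := fun i => by
    have h1 : Tendsto (fun τ => ∑ n, (B n i : ℂ) * cdot (v τ) (toC3 (B n))) atTop
        (𝓝 (∑ n : Fin 3, (B n i : ℂ) * 0)) :=
      tendsto_finsetSum _ fun n _ => (hall n).const_mul _
    simp only [mul_zero, Finset.sum_const_zero] at h1
    exact h1.congr fun τ => (apply_eq_sum_cdot B (v τ) i).symm
  have hsum := ((hcomp 0).norm.add (hcomp 1).norm).add (hcomp 2).norm
  simp only [norm_zero, add_zero] at hsum
  exact squeeze_zero_norm (fun τ => norm_le_sum_norm (v τ)) hsum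

variable {a : R3} {θ0 r0 : ℝ}

open scoped Pointwise in
theorem volume_real_ball_inter_truncCone (ha : ‖a‖ = 1) (hθ0 : 0 < θ0) (hθ0' : θ0 < Real.pi / 2)
    {ρ : ℝ} (hρ : 0 < ρ) (hρr : ρ ≤ r0) :
    volume.real (Metric.ball 0 ρ ∩ truncCone a θ0 r0) =
      ρ ^ 3 * volume.real (Metric.ball 0 1 ∩ cone a θ0) := by
  have h : Metric.ball 0 ρ ∩ truncCone a θ0 r0 = ρ • (Metric.ball 0 1 ∩ cone a θ0) := by
    ext x
    rw [mem_smul_set_iff_inv_smul_mem₀ hρ.ne']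
    simp only [truncCone, mem_inter_iff, smul_mem_cone_iff ha hθ0 hθ0' (inv_pos.2 hρ),
      mem_ball_zero_iff, norm_smul, norm_inv, Real.norm_of_nonneg hρ.le, inv_mul_lt_iff₀ hρ, mul_one]
    exact ⟨fun h => ⟨h.1, h.2.1⟩, fun h => ⟨h.1, h.2, h.1.trans_le hρr⟩⟩
  rw [h, measureReal_def, Measure.addHaar_smul, ENNReal.toReal_mul, measureReal_def]
  simp [abs_of_pos hρ, hρ.le]

theorem volume_real_ball_inter_cone_pos (ha : ‖a‖ = 1) (hθ0 : 0 < θ0) (hθ0' : θ0 < Real.pi / 2) :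
    0 < volume.real (Metric.ball 0 1 ∩ cone a θ0) := by
  have hcos1 : Real.cos θ0 < 1 := by
    rw [← Real.cos_zero]
    exact Real.cos_lt_cos_of_nonneg_of_le_pi le_rfl (by linarith) hθ0
  refine ENNReal.toReal_pos (IsOpen.measure_pos volume
    (Metric.isOpen_ball.inter (isOpen_cone ha hθ0 hθ0')) ⟨(1 / 2 : ℝ) • a, ?_, ?_⟩).ne' ?_
  · rw [mem_ball_zero_iff, norm_smul, ha]; norm_num
  · rw [smul_mem_cone_iff ha hθ0 hθ0' (by norm_num), mem_cone_iff ha hθ0 hθ0', ha,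
      real_inner_self_eq_norm_sq, ha]
    linarith
  · exact ((measure_mono inter_subset_left).trans_lt measure_ball_lt_top).ne

theorem IsScaleApprox.average_le {U : R3 → C3} {G : ℝ → R3 → C3} {δ N : ℝ → ℝ}
    (h : IsScaleApprox (truncCone a θ0 r0) U G δ N) {ρ τ : ℝ} (hτ : 0 < τ)
    (hv : 0 < volume.real (Metric.ball 0 ρ ∩ truncCone a θ0 r0)) :
    (volume.real (Metric.ball 0 ρ ∩ truncCone a θ0 r0))⁻¹ *
        ∫ x in Metric.ball 0 ρ ∩ truncCone a θ0 r0, ‖U x‖ ≤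
      δ τ / Real.sqrt (volume.real (Metric.ball 0 ρ ∩ truncCone a θ0 r0)) +
        (‖G τ 0‖ + N τ * ρ) := by
  set S := Metric.ball (0 : R3) ρ ∩ truncCone a θ0 r0 with hS
  have hsub : S ⊆ truncCone a θ0 r0 := inter_subset_right
  have hfin : volume S ≠ ⊤ := ((measure_mono hsub).trans_lt (volume_truncCone_lt_top a θ0 r0)).ne
  have : IsFiniteMeasure (volume.restrict S) := ⟨by simpa using hfin.lt_top⟩
  have hUG : IntegrableOn (fun x => U x - G τ x) (truncCone a θ0 r0) :=
    h.integrableOn.sub (h.integrableOn_approx τ)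
  have hi1 : Integrable (fun x => ‖U x - G τ x‖) (volume.restrict S) :=
    Integrable.norm (hUG.mono_set hsub)
  have hi2 : Integrable (fun _ : R3 => ‖G τ 0‖ + N τ * ρ) (volume.restrict S) :=
    integrable_const _
  have hcs : ∫ x in S, ‖U x - G τ x‖ ≤ δ τ * Real.sqrt (volume.real S) := by
    have h1 := integral_norm_mul_le_of_eLpNorm_le (ν := volume.restrict S)
      (U := fun x => U x - G τ x) (w := fun _ => 1) (δ := δ τ) (B := volume.real S)
      (hUG.mono_set hsub).aestronglyMeasurable (h.delta_nonneg τ)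
      ((eLpNorm_mono_measure _ (Measure.restrict_mono hsub le_rfl)).trans (h.eLpNorm_sub_le τ hτ))
      (memLp_const _) (fun _ => zero_le_one) (by simp)
    simpa using h1
  have hle : ∫ x in S, ‖U x‖ ≤ ∫ x in S, (‖U x - G τ x‖ + (‖G τ 0‖ + N τ * ρ)) := by
    refine integral_mono_ae (Integrable.norm (h.integrableOn.mono_set hsub)) (hi1.add hi2) ?_
    have hSm : ∀ᵐ x ∂(volume.restrict S), x ∈ Metric.ball (0 : R3) ρ := by
      refine ae_restrict_of_ae_restrict_of_subset (t := Metric.ball (0 : R3) ρ) inter_subset_left ?_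
      exact ae_restrict_mem Metric.isOpen_ball.measurableSet
    filter_upwards [hSm] with x hx
    rw [mem_ball_zero_iff] at hx
    have e1 : ‖U x‖ ≤ ‖U x - G τ x‖ + ‖G τ x - G τ 0‖ + ‖G τ 0‖ := by
      have := norm_add₃_le (a := U x - G τ x) (b := G τ x - G τ 0) (c := G τ 0)
      simpa using this
    have e2 := (h.norm_sub_le τ x).trans
      (mul_le_mul_of_nonneg_left hx.le (h.bound_nonneg τ))
    linarith
  rw [integral_add hi1 hi2, setIntegral_const, smul_eq_mul] at hle
  have h2 := mul_le_mul_of_nonneg_left (hle.trans (add_le_add_left hcs _)) (inv_nonneg.2 hv.le)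
  refine h2.trans (le_of_eq ?_)
  rw [mul_add, inv_mul_cancel_left₀ hv.ne']
  congr 1
  have h3 : Real.sqrt (volume.real S) ≠ 0 := (Real.sqrt_pos.2 hv).ne'
  nth_rewrite 1 [← Real.sq_sqrt hv.le]
  field_simp

/-- Take `τ = 1 / ρ` in `IsScaleApprox.average_le`. The volume is a multiple of `ρ ^ 3`, so the two
error terms become the quantities `τ^(3/2) δ τ` and `N τ / τ`, which vanish in the limit. -/
theorem IsScaleApprox.tendsto_average (ha : ‖a‖ = 1) (hθ0 : 0 < θ0) (hθ0' : θ0 < Real.pi / 2)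
    (hr0 : 0 < r0) {U : R3 → C3} {G : ℝ → R3 → C3} {δ N : ℝ → ℝ}
    (h : IsScaleApprox (truncCone a θ0 r0) U G δ N) (hG : Tendsto (fun τ => G τ 0) atTop (𝓝 0)) :
    Tendsto (fun ρ : ℝ => (volume.real (Metric.ball 0 ρ ∩ truncCone a θ0 r0))⁻¹ *
      ∫ x in Metric.ball 0 ρ ∩ truncCone a θ0 r0, ‖U x‖) (𝓝[>] 0) (𝓝 0) := by
  set v := volume.real (Metric.ball 0 1 ∩ cone a θ0) with hv
  have hv0 : 0 < v := volume_real_ball_inter_cone_pos ha hθ0 hθ0'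
  have hlim := (h.tendsto_delta.const_mul (Real.sqrt v)⁻¹).add (hG.norm.add h.tendsto_bound)
  rw [mul_zero, norm_zero, add_zero, add_zero] at hlim
  have hlim' := hlim.comp tendsto_inv_nhdsGT_zero
  refine squeeze_zero' (.of_forall fun ρ => mul_nonneg (by positivity)
    (integral_nonneg fun x => norm_nonneg _)) ?_ hlim'
  filter_upwards [Ioo_mem_nhdsGT hr0] with ρ hρ
  have hvol := volume_real_ball_inter_truncCone ha hθ0 hθ0' hρ.1 hρ.2.le
  rw [← hv] at hvol
  have hρ3 : 0 < ρ ^ 3 := pow_pos hρ.1 3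
  have h1 := h.average_le (ρ := ρ) (inv_pos.2 hρ.1) (by rw [hvol]; positivity)
  refine h1.trans (le_of_eq ?_)
  simp only [Function.comp_apply]
  rw [hvol, Real.sqrt_mul hρ3.le, inv_pow, Real.sqrt_inv, div_inv_eq_mul]
  have := hρ.1.ne'
  field_simp

end

/-! ### Herglotz waves as approximations at scale `1 / τ`. -/

instance isFiniteMeasure_sphereMeasure : IsFiniteMeasure sphereMeasure := by
  unfold sphereMeasure; infer_instance

theorem integral_norm_le_of_eLpNorm_le {g : S2 → C3} {B : ℝ} (hg : MemLp g 2 sphereMeasure)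
    (hB : 0 ≤ B) (h : eLpNorm g 2 sphereMeasure ≤ ENNReal.ofReal B) :
    ∫ d, ‖g d‖ ∂sphereMeasure ≤ B * Real.sqrt (sphereMeasure.real univ) := by
  have h1 := integral_norm_mul_le_of_eLpNorm_le (U := g) (w := fun _ => 1)
    (B := sphereMeasure.real univ) hg.aestronglyMeasurable hB h (memLp_const _)
    (fun _ => zero_le_one) (by simp)
  simpa using h1

theorem norm_cexp_I_mul_ofReal (s : ℝ) : ‖Complex.exp (Complex.I * s)‖ = 1 := by
  rw [mul_comm, Complex.norm_exp_ofReal_mul_I]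

theorem norm_cexp_I_mul_sub_le (s t : ℝ) :
    ‖Complex.exp (Complex.I * s) - Complex.exp (Complex.I * t)‖ ≤ |s - t| := by
  have h : Complex.exp (Complex.I * s) - Complex.exp (Complex.I * t) =
      Complex.exp (Complex.I * t) * (Complex.exp (Complex.I * ((s - t : ℝ) : ℂ)) - 1) := by
    rw [mul_sub, ← Complex.exp_add, mul_one]
    congr 2
    push_cast
    ring
  rw [h, norm_mul, norm_cexp_I_mul_ofReal, one_mul]
  exact Real.norm_exp_I_mul_ofReal_sub_one_le

theorem integrable_herglotz {g : S2 → C3} (hg : Integrable g sphereMeasure) (k : ℝ) (x : R3) :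
    Integrable (fun d : S2 => Complex.exp (Complex.I * k * (inner ℝ x (d : R3) : ℝ)) • g d)
      sphereMeasure := by
  have hc : Continuous fun d : S2 => Complex.exp (Complex.I * k * (inner ℝ x (d : R3) : ℝ)) := by
    fun_prop
  refine (Integrable.norm hg).mono' (hc.aestronglyMeasurable.smul hg.aestronglyMeasurable)
    (.of_forall fun d => ?_)
  have h := norm_cexp_I_mul_ofReal (k * inner ℝ x (d : R3))
  push_cast at h
  rw [norm_smul, mul_assoc, h, one_mul]

theorem norm_herglotz_le (g : S2 → C3) (k : ℝ) (x : R3) :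
    ‖herglotz k g x‖ ≤ ∫ d, ‖g d‖ ∂sphereMeasure := by
  refine (norm_integral_le_integral_norm _).trans (le_of_eq (integral_congr_ae
    (.of_forall fun d => ?_)))
  have h := norm_cexp_I_mul_ofReal (k * inner ℝ x (d : R3))
  push_cast at h
  simp only [norm_smul, mul_assoc, h, one_mul]

theorem norm_herglotz_sub_le {g : S2 → C3} (hg : Integrable g sphereMeasure) (k : ℝ) (x y : R3) :
    ‖herglotz k g x - herglotz k g y‖ ≤ |k| * (∫ d, ‖g d‖ ∂sphereMeasure) * ‖x - y‖ := by
  rw [herglotz, herglotz, ← integral_sub (integrable_herglotz hg k x) (integrable_herglotz hg k y),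
    mul_right_comm, ← integral_const_mul]
  refine norm_integral_le_of_norm_le (hg.norm.const_mul _) (.of_forall fun d => ?_)
  rw [← sub_smul, norm_smul]
  refine mul_le_mul_of_nonneg_right ?_ (norm_nonneg _)
  have h := norm_cexp_I_mul_sub_le (k * inner ℝ x (d : R3)) (k * inner ℝ y (d : R3))
  rw [← mul_sub, ← inner_sub_left, abs_mul] at h
  push_cast at h
  simp only [mul_assoc]
  refine h.trans (mul_le_mul_of_nonneg_left ?_ (abs_nonneg k))
  have h2 := abs_real_inner_le_norm (x - y) (d : R3)
  rwa [norm_eq_of_mem_sphere d, mul_one] at h2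

theorem continuous_herglotz {g : S2 → C3} (hg : Integrable g sphereMeasure) (k : ℝ) :
    Continuous (herglotz k g) := by
  refine (LipschitzWith.of_dist_le_mul (K := ⟨|k| * ∫ d, ‖g d‖ ∂sphereMeasure, mul_nonneg
    (abs_nonneg k) (integral_nonneg fun _ => norm_nonneg _)⟩) fun x y => ?_).continuous
  rw [dist_eq_norm, dist_eq_norm]
  exact norm_herglotz_sub_le hg k x y

theorem eLpNorm_le_hcurlNorm (U : R3 → C3) (D : Set R3) :
    eLpNorm U 2 (volume.restrict D) ≤ hcurlNorm U D := by
  refine le_iInf₂ fun C _ => ?_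
  calc eLpNorm U 2 (volume.restrict D)
      = (eLpNorm U 2 (volume.restrict D) ^ 2) ^ (1 / 2 : ℝ) := by
        rw [← ENNReal.rpow_natCast, ← ENNReal.rpow_mul]; norm_num
    _ ≤ _ := ENNReal.rpow_le_rpow le_self_add (by norm_num)

theorem IsScaleApprox.neg {K : Set R3} {U : R3 → C3} {G : ℝ → R3 → C3} {δ N : ℝ → ℝ}
    (h : IsScaleApprox K U G δ N) : IsScaleApprox K (fun x => -U x) (fun τ x => -G τ x) δ N where
  memLp := h.memLp.neg
  continuous τ := (h.continuous τ).neg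
  delta_nonneg := h.delta_nonneg
  eLpNorm_sub_le τ hτ := by
    have h1 : (fun x => -U x - -G τ x) = -fun x => U x - G τ x := by
      funext x; simp [neg_add_eq_sub]
    rw [h1, eLpNorm_neg]
    exact h.eLpNorm_sub_le τ hτ
  norm_le τ x := by rw [norm_neg]; exact h.norm_le τ x
  norm_sub_le τ x := by
    rw [neg_sub_neg, norm_sub_rev]; exact h.norm_sub_le τ x
  tendsto_delta := h.tendsto_delta
  tendsto_bound := h.tendsto_bound

/-- Herglotz approximations at the rate `j ^ (-ζ)` with kernels of size `j ^ β`, `β < 2 ζ / 3`,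
give approximations adapted to the scale `1 / τ`, with `j ∼ τ ^ s`, `3 / (2 ζ) < s < 1 / β`. -/
theorem exists_isScaleApprox {K : Set R3} {U : R3 → C3} (hU : MemLp U 2 (volume.restrict K))
    (k : ℝ) {ζ β : ℝ} (hζ : 0 < ζ) (hβ : 0 < β) (hβζ : β < 2 / 3 * ζ) {g : ℕ → S2 → C3}
    (hg : ∀ j : ℕ, 1 ≤ j → MemLp (g j) 2 sphereMeasure)
    (hUg : ∀ j : ℕ, 1 ≤ j → hcurlNorm (fun x => U x - herglotz k (g j) x) K ≤
      ENNReal.ofReal ((j : ℝ) ^ (-ζ)))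
    (hgn : ∀ j : ℕ, 1 ≤ j → eLpNorm (g j) 2 sphereMeasure ≤ ENNReal.ofReal ((j : ℝ) ^ β)) :
    ∃ G δ N, IsScaleApprox K U G δ N := by
  -- The lower bound gives `τ^(-s ζ) = o(τ^(-3/2))`, the upper one `τ^(s β) = o(τ)`. The interval is
  -- nonempty exactly because `β < 2 ζ / 3`.
  obtain ⟨s, hs1, hs2⟩ : ∃ s, 3 / (2 * ζ) < s ∧ s < 1 / β := by
    refine exists_between ?_
    rw [div_lt_div_iff₀ (by positivity) hβ]
    linarith
  rw [div_lt_iff₀ (by positivity)] at hs1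
  rw [lt_div_iff₀ hβ] at hs2
  have hs : 0 < s := pos_of_mul_pos_left (lt_trans (by norm_num) hs1) (by positivity)
  -- The added `1` keeps the index in the range `j ≥ 1` for every real `τ`.
  let j : ℝ → ℕ := fun τ => ⌈τ ^ s⌉₊ + 1
  have hj : ∀ τ, 1 ≤ j τ := fun τ => Nat.le_add_left _ _
  have hjle : ∀ τ, τ ^ s ≤ (j τ : ℝ) := fun τ => by
    simp only [j]; push_cast
    linarith [Nat.le_ceil (τ ^ s)]
  have hjge : ∀ τ : ℝ, 1 ≤ τ → (j τ : ℝ) ≤ 3 * τ ^ s := fun τ hτ => by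
    have h1 : 1 ≤ τ ^ s := Real.one_le_rpow hτ hs.le
    simp only [j]; push_cast
    linarith [Nat.ceil_lt_add_one (zero_le_one.trans h1)]
  set c := Real.sqrt (sphereMeasure.real univ) with hc
  have hc0 : 0 ≤ c := Real.sqrt_nonneg _
  have hint : ∀ τ, Integrable (g (j τ)) sphereMeasure := fun τ =>
    (hg _ (hj τ)).integrable one_le_two
  have hL1 : ∀ τ, ∫ d, ‖g (j τ) d‖ ∂sphereMeasure ≤ (j τ : ℝ) ^ β * c := fun τ =>
    integral_norm_le_of_eLpNorm_le (hg _ (hj τ)) (by positivity) (hgn _ (hj τ))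
  -- The factor `1 + |k|` lets one bound serve both the sup norm, which needs `1`, and the Lipschitz
  -- constant, which needs `|k|`.
  refine ⟨fun τ => herglotz k (g (j τ)), fun τ => (j τ : ℝ) ^ (-ζ),
    fun τ => (1 + |k|) * ((j τ : ℝ) ^ β * c), ?_⟩
  refine ⟨hU, fun τ => continuous_herglotz (hint τ) k, fun τ => by positivity,
    fun τ _ => (eLpNorm_le_hcurlNorm _ _).trans (hUg _ (hj τ)), fun τ x => ?_, fun τ x => ?_, ?_, ?_⟩
  · refine ((norm_herglotz_le _ k x).trans (hL1 τ)).trans (le_mul_of_one_le_left (by positivity) ?_)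
    linarith [abs_nonneg k]
  · have h1 := norm_herglotz_sub_le (hint τ) k x 0
    rw [sub_zero] at h1
    refine h1.trans (mul_le_mul_of_nonneg_right ?_ (norm_nonneg x))
    refine mul_le_mul (by linarith) (hL1 τ) (integral_nonneg fun _ => norm_nonneg _) ?_
    linarith [abs_nonneg k]
  · have hlim := tendsto_rpow_neg_atTop (y := s * ζ - 3 / 2) (by linarith)
    refine squeeze_zero' (.of_forall fun τ => by positivity) ?_ hlim
    filter_upwards [eventually_gt_atTop 0] with τ hτ
    have h1 : (j τ : ℝ) ^ (-ζ) ≤ (τ ^ s) ^ (-ζ) :=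
      Real.rpow_le_rpow_of_nonpos (Real.rpow_pos_of_pos hτ s) (hjle τ) (by linarith)
    refine (mul_le_mul_of_nonneg_left h1 (Real.sqrt_nonneg _)).trans (le_of_eq ?_)
    rw [Real.sqrt_eq_rpow, ← Real.rpow_natCast, ← Real.rpow_mul hτ.le, ← Real.rpow_mul hτ.le,
      ← Real.rpow_add hτ]
    congr 1
    push_cast
    ring
  · have hlim := (tendsto_rpow_neg_atTop (y := 1 - s * β) (by linarith)).const_mul
      ((1 + |k|) * (3 ^ β * c))
    rw [mul_zero] at hlim
    refine squeeze_zero' ?_ ?_ hlim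
    · filter_upwards [eventually_gt_atTop 0] with τ hτ
      positivity
    · filter_upwards [eventually_ge_atTop 1] with τ hτ1
      have hτ : 0 < τ := by linarith
      have h1 : (j τ : ℝ) ^ β ≤ 3 ^ β * τ ^ (s * β) := by
        rw [Real.rpow_mul hτ.le, ← Real.mul_rpow (by norm_num) (by positivity)]
        exact Real.rpow_le_rpow (by positivity) (hjge τ hτ1) hβ.le
      have h2 : τ ^ (-(1 - s * β)) = τ ^ (s * β) / τ := by
        rw [neg_sub, Real.rpow_sub_one hτ.ne']
      rw [h2]
      calc (1 + |k|) * ((j τ : ℝ) ^ β * c) / τ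
          ≤ (1 + |k|) * (3 ^ β * τ ^ (s * β) * c) / τ := by gcongr
        _ = _ := by ring

/-! ### Localization of the transmission conditions, and the conclusion. -/

theorem continuous_curl {φ : R3 → C3} (hφ : ContDiff ℝ (⊤ : ℕ∞) φ) : Continuous (curl φ) := by
  have h : ∀ i k, Continuous (partialDeriv i k φ) := fun i k => by
    have h1 : Continuous fun x => fderiv ℝ φ x (EuclideanSpace.single i 1) :=
      (hφ.continuous_fderiv (by simp)).clm_apply continuous_const
    exact (EuclideanSpace.proj (𝕜 := ℂ) k).continuous.comp h1
  refine (PiLp.continuous_toLp 2 _).comp (continuous_pi fun i => ?_)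
  fin_cases i <;> simp <;> exact (h _ _).sub (h _ _)

theorem curl_eq_zero {φ : R3 → C3} {x : R3} (hx : x ∉ tsupport φ) : curl φ x = 0 := by
  have h : fderiv ℝ φ x = 0 := by
    by_contra h
    exact hx (support_fderiv_subset ℝ h)
  rw [C3.ext_iff]
  simp [curl, partialDeriv, h]

/-- Both `φ` and `curl φ` vanish on `Ω \ K`, so equality of traces becomes an identity on `K`. No
condition is put on `φ` along the part of the boundary inside `Γ`. -/
theorem TangentialTraceEqOn.integral_cdot_eq {Ω Γ K : Set R3} {U U' C C' : R3 → C3}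
    (h : TangentialTraceEqOn Ω Γ U U') (hC : HasWeakCurl U C Ω) (hC' : HasWeakCurl U' C' Ω)
    (hΩ : MeasurableSet Ω) (hKΩ : K ⊆ Ω) (hU : IntegrableOn U K)
    (hU' : IntegrableOn U' K) (hCi : IntegrableOn C K) (hCi' : IntegrableOn C' K) {φ : R3 → C3}
    (hφ : ContDiff ℝ (⊤ : ℕ∞) φ) (hφc : HasCompactSupport φ)
    (hφΓ : Disjoint (tsupport φ) (frontier Ω \ Γ)) (hφK : Ω ∩ tsupport φ ⊆ K) :
    ∫ x in K, cdot (C x - C' x) (φ x) = ∫ x in K, cdot (U x - U' x) (curl φ x) := by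
  have hcc : HasCompactSupport (curl φ) :=
    HasCompactSupport.intro hφc fun x hx => curl_eq_zero hx
  have hc0 : ∀ u : C3, cdot u 0 = 0 := fun u => by simp [cdot_eq]
  have hred : ∀ V W : R3 → C3, ∫ x in Ω, (cdot (V x) (φ x) - cdot (W x) (curl φ x)) =
      ∫ x in K, (cdot (V x) (φ x) - cdot (W x) (curl φ x)) := fun V W => by
    refine setIntegral_eq_of_subset_of_forall_sdiff_eq_zero hΩ hKΩ fun x hx => ?_
    have hx' : x ∉ tsupport φ := fun h' => hx.2 (hφK ⟨hx.1, h'⟩)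
    rw [image_eq_zero_of_notMem_tsupport hx', curl_eq_zero hx', hc0, hc0, sub_zero]
  have h1 := h C C' hC hC' φ hφ hφc hφΓ
  have i1 := integrableOn_cdot hCi hφ.continuous hφc
  have i2 := integrableOn_cdot hCi' hφ.continuous hφc
  have i3 := integrableOn_cdot hU (continuous_curl hφ) hcc
  have i4 := integrableOn_cdot hU' (continuous_curl hφ) hcc
  rw [hred, hred, integral_sub i1 i3, integral_sub i2 i4] at h1
  simp only [sub_cdot]
  rw [integral_sub i1 i2, integral_sub i3 i4]
  linear_combination h1

theorem exists_isCutoff {R r0 : ℝ} (hR : 0 < R) (hRr : R ≤ r0) :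
    ∃ χ : R3 → ℂ, IsCutoff χ (R / 2) r0 ∧ tsupport χ ⊆ Metric.closedBall 0 R := by
  let f : ContDiffBump (0 : R3) := ⟨R / 2, R, by positivity, by linarith⟩
  have hsub : tsupport (fun x => ((f x : ℝ) : ℂ)) ⊆ tsupport f :=
    closure_mono fun x hx hx' => hx (by simp [hx'])
  refine ⟨fun x => ((f x : ℝ) : ℂ), ⟨Complex.ofRealCLM.contDiff.comp f.contDiff,
    f.hasCompactSupport.mono fun x hx hx' => hx (by simp [hx']), fun x => ?_, by positivity,
    fun x hx => ?_, fun x hx => ?_⟩, hsub.trans f.tsupport_eq.subset⟩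
  · rw [Complex.norm_real, Real.norm_of_nonneg f.nonneg]; exact f.le_one
  · rw [f.one_of_mem_closedBall (by simpa using hx.le)]; simp
  · rw [f.zero_of_le_dist (by simpa using hRr.trans hx)]; simp

theorem tendsto_average_of_transmission {a : R3} {θ0 r0 r : ℝ} {χ : R3 → ℂ} (ha : ‖a‖ = 1)
    (hθ0 : 0 < θ0) (hθ0' : θ0 < Real.pi / 2) (hr0 : 0 < r0) (hχ : IsCutoff χ r r0)
    {E H E0 H0 : R3 → C3} {G G' : ℝ → R3 → C3} {δ N δ' N' : ℝ → ℝ}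
    (hEG : IsScaleApprox (truncCone a θ0 r0) E G δ N)
    (hHG : IsScaleApprox (truncCone a θ0 r0) H G' δ' N')
    (hE0i : IntegrableOn E0 (truncCone a θ0 r0)) (hH0i : IntegrableOn H0 (truncCone a θ0 r0))
    {ω μ γ μ0 ε0 : ℝ} (hω : 0 < ω) (hμ0 : 0 < μ0) (hε0 : 0 < ε0)
    (hE : ∀ φ : R3 → C3, ContDiff ℝ (⊤ : ℕ∞) φ → tsupport φ ⊆ tsupport χ →
      ∫ x in truncCone a θ0 r0, cdot ((Complex.I * ω) • ((μ : ℂ) • H x - (μ0 : ℂ) • H0 x)) (φ x) =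
        ∫ x in truncCone a θ0 r0, cdot (E x - E0 x) (curl φ x))
    (hH : ∀ φ : R3 → C3, ContDiff ℝ (⊤ : ℕ∞) φ → tsupport φ ⊆ tsupport χ →
      ∫ x in truncCone a θ0 r0,
        cdot ((-(Complex.I * ω)) • ((γ : ℂ) • E x - (ε0 : ℂ) • E0 x)) (φ x) =
        ∫ x in truncCone a θ0 r0, cdot (H x - H0 x) (curl φ x))
    (hγ : γ ≠ ε0) :
    Tendsto (fun ρ : ℝ => (volume.real (Metric.ball 0 ρ ∩ truncCone a θ0 r0))⁻¹ *
      ∫ x in Metric.ball 0 ρ ∩ truncCone a θ0 r0, ‖E x‖) (𝓝[>] 0) (𝓝 0) := by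
  refine hEG.tendsto_average ha hθ0 hθ0' hr0 (tendsto_zero_of_cdot_elecPol ha
    (tendsto_sqrt_sq_add_div (ω ^ 2 * ε0 * μ0)) fun b hb hab => ?_)
  exact tendsto_cdot_elecPol ha hb hab hθ0 hθ0' hχ hEG _ (tendsto_integral_elecPol ha hb hab hθ0 hθ0'
    hχ hEG.integrableOn hHG hE0i hH0i hω hε0 hE hH hγ (fun τ => Real.sq_sqrt (by positivity))
    (tendsto_sqrt_sq_add_div _))

end ConicalMaxwell

end

open ConicalMaxwell in
theorem theorem4p2
    (Ω Γ : Set ConicalMaxwell.R3) (hΩ : IsOpen Ω)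
    (hΓ : ∃ O : Set ConicalMaxwell.R3, IsOpen O ∧ Γ = O ∩ frontier Ω)
    (h0 : (0 : ConicalMaxwell.R3) ∈ Γ)
    (a : ConicalMaxwell.R3) (ha : ‖a‖ = 1)
    (θ0 r0 : ℝ) (hθ0 : 0 < θ0) (hθ0' : θ0 < Real.pi / 2) (hr0 : 0 < r0)
    (hcorner : Ω ∩ Metric.ball 0 r0 = ConicalMaxwell.truncCone a θ0 r0)
    (ω μ γ μ0 ε0 : ℝ) (hω : 0 < ω) (hμ : 0 < μ) (hγ : 0 < γ) (hμ0 : 0 < μ0) (hε0 : 0 < ε0)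
    (Et Ht E0 H0 : ConicalMaxwell.R3 → ConicalMaxwell.C3)
    (heig : ConicalMaxwell.IsTransmissionEigenpair Ω Γ ω μ γ μ0 ε0 Et Ht E0 H0)
    (ζ β ζ' β' : ℝ) (hζ : 0 < ζ) (hβ : 0 < β) (hζ' : 0 < ζ') (hβ' : 0 < β')
    (hβζ : β < 2 / 3 * ζ) (hβζ' : β' < 2 / 3 * ζ')
    (g f : ℕ → ConicalMaxwell.S2 → ConicalMaxwell.C3)
    (hg : ∀ j : ℕ, 1 ≤ j → MeasureTheory.MemLp (g j) 2 ConicalMaxwell.sphereMeasure)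
    (hf : ∀ j : ℕ, 1 ≤ j → MeasureTheory.MemLp (f j) 2 ConicalMaxwell.sphereMeasure)
    (hE : ∀ j : ℕ, 1 ≤ j →
      ConicalMaxwell.hcurlNorm
        (fun x => Et x - ConicalMaxwell.herglotz (ω * Real.sqrt (μ * γ)) (g j) x)
        (ConicalMaxwell.truncCone a θ0 r0) ≤ ENNReal.ofReal ((j : ℝ) ^ (-ζ)))
    (hgn : ∀ j : ℕ, 1 ≤ j →
      MeasureTheory.eLpNorm (g j) 2 ConicalMaxwell.sphereMeasure ≤ ENNReal.ofReal ((j : ℝ) ^ β))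
    (hH : ∀ j : ℕ, 1 ≤ j →
      ConicalMaxwell.hcurlNorm
        (fun x => Ht x - ConicalMaxwell.herglotz (ω * Real.sqrt (μ * γ)) (f j) x)
        (ConicalMaxwell.truncCone a θ0 r0) ≤ ENNReal.ofReal ((j : ℝ) ^ (-ζ')))
    (hfn : ∀ j : ℕ, 1 ≤ j →
      MeasureTheory.eLpNorm (f j) 2 ConicalMaxwell.sphereMeasure ≤
        ENNReal.ofReal ((j : ℝ) ^ β')) :
    (γ ≠ ε0 →
      Filter.Tendsto
        (fun ρ : ℝ =>
          (MeasureTheory.volume.real (Metric.ball 0 ρ ∩ ConicalMaxwell.truncCone a θ0 r0))⁻¹ *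
            ∫ x in Metric.ball 0 ρ ∩ ConicalMaxwell.truncCone a θ0 r0, ‖Et x‖)
        (nhdsWithin 0 (Set.Ioi 0)) (nhds 0)) ∧
    (μ ≠ μ0 →
      Filter.Tendsto
        (fun ρ : ℝ =>
          (MeasureTheory.volume.real (Metric.ball 0 ρ ∩ ConicalMaxwell.truncCone a θ0 r0))⁻¹ *
            ∫ x in Metric.ball 0 ρ ∩ ConicalMaxwell.truncCone a θ0 r0, ‖Ht x‖)
        (nhdsWithin 0 (Set.Ioi 0)) (nhds 0)) := by
  obtain ⟨O, hO, rfl⟩ := hΓ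
  -- A cutoff supported in this ball avoids `∂Ω \ Γ`, and within `Ω` its support lies in the
  -- truncated cone.
  obtain ⟨R, hR, hRO⟩ : ∃ R > 0, Metric.closedBall (0 : R3) R ⊆ O ∩ Metric.ball 0 r0 :=
    Metric.nhds_basis_closedBall.mem_iff.1
      (Filter.inter_mem (hO.mem_nhds h0.1) (Metric.ball_mem_nhds 0 hr0))
  have hRr : R ≤ r0 := by
    have h1 : R • a ∈ Metric.closedBall (0 : R3) R := by
      simp [norm_smul, ha, abs_of_pos hR]
    have h2 := (hRO h1).2
    rw [mem_ball_zero_iff, norm_smul, ha, mul_one, Real.norm_of_nonneg hR.le] at h2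
    exact h2.le
  obtain ⟨χ, hχ, hχs⟩ := exists_isCutoff hR hRr
  have hKΩ : truncCone a θ0 r0 ⊆ Ω := hcorner ▸ Set.inter_subset_left
  have hL2 : ∀ {U : R3 → C3}, MemHcurl U Ω →
      MeasureTheory.MemLp U 2 (MeasureTheory.volume.restrict (truncCone a θ0 r0)) := fun hU =>
    hU.1.mono_measure (MeasureTheory.Measure.restrict_mono hKΩ le_rfl)
  have hEt := hL2 heig.memHcurl_Et
  have hHt := hL2 heig.memHcurl_Ht
  have iEt := integrableOn_truncCone hEt
  have iHt := integrableOn_truncCone hHt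
  have iE0 := integrableOn_truncCone (hL2 heig.memHcurl_E0)
  have iH0 := integrableOn_truncCone (hL2 heig.memHcurl_H0)
  have hsmul : ∀ (c : ℂ) {U : R3 → C3}, MeasureTheory.IntegrableOn U (truncCone a θ0 r0) →
      MeasureTheory.IntegrableOn (fun x => c • U x) (truncCone a θ0 r0) :=
    fun c _ h => MeasureTheory.Integrable.smul c h
  obtain ⟨G, δ, N, hG⟩ := exists_isScaleApprox hEt _ hζ hβ hβζ hg hE hgn
  obtain ⟨G', δ', N', hG'⟩ := exists_isScaleApprox hHt _ hζ' hβ' hβζ' hf hH hfn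
  have hsupp : ∀ φ : R3 → C3, tsupport φ ⊆ tsupport χ → HasCompactSupport φ ∧
      Disjoint (tsupport φ) (frontier Ω \ (O ∩ frontier Ω)) ∧
      Ω ∩ tsupport φ ⊆ truncCone a θ0 r0 := fun φ hφ => by
    have h1 := (hφ.trans hχs).trans hRO
    refine ⟨hχ.hasCompactSupport.of_isClosed_subset (isClosed_tsupport φ) hφ, ?_, ?_⟩
    · exact Set.disjoint_left.2 fun x hx hx' => hx'.2 ⟨(h1 hx).1, hx'.1⟩
    · rw [← hcorner]
      exact fun x hx => ⟨hx.1, (h1 hx.2).2⟩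
  have weakE : ∀ φ : R3 → C3, ContDiff ℝ (⊤ : ℕ∞) φ → tsupport φ ⊆ tsupport χ →
      ∫ x in truncCone a θ0 r0,
        cdot ((Complex.I * ω) • ((μ : ℂ) • Ht x - (μ0 : ℂ) • H0 x)) (φ x) =
        ∫ x in truncCone a θ0 r0, cdot (Et x - E0 x) (curl φ x) := fun φ hφ hφs => by
    obtain ⟨hc, hd, hK⟩ := hsupp φ hφs
    rw [← heig.trace_E.integral_cdot_eq heig.curl_Et heig.curl_E0 hΩ.measurableSet hKΩ iEt iE0
      (hsmul _ iHt) (hsmul _ iH0) hφ hc hd hK]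
    simp only [smul_sub, smul_smul]
  have weakH : ∀ φ : R3 → C3, ContDiff ℝ (⊤ : ℕ∞) φ → tsupport φ ⊆ tsupport χ →
      ∫ x in truncCone a θ0 r0,
        cdot ((-(Complex.I * ω)) • ((γ : ℂ) • Et x - (ε0 : ℂ) • E0 x)) (φ x) =
        ∫ x in truncCone a θ0 r0, cdot (Ht x - H0 x) (curl φ x) := fun φ hφ hφs => by
    obtain ⟨hc, hd, hK⟩ := hsupp φ hφs
    rw [← heig.trace_H.integral_cdot_eq heig.curl_Ht heig.curl_H0 hΩ.measurableSet hKΩ iHt iH0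
      (hsmul _ iEt) (hsmul _ iE0) hφ hc hd hK]
    simp only [smul_sub, smul_smul, neg_mul]
  refine ⟨fun hne => ?_, fun hne => ?_⟩
  · exact tendsto_average_of_transmission ha hθ0 hθ0' hr0 hχ hG hG' iE0 iH0 hω hμ0 hε0
      weakE weakH hne
  -- Maxwell duality: `(H, -E)` solves the same system with permittivity and permeability exchanged,
  -- so the electric result applies with `μ ≠ μ0` in place of `γ ≠ ε0`.
  · refine tendsto_average_of_transmission (E := Ht) (H := fun x => -Et x) (E0 := H0)
      (H0 := fun x => -E0 x) ha hθ0 hθ0' hr0 hχ hG' hG.neg iH0 iE0.neg hω hε0 hμ0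
      (μ := γ) (γ := μ) (μ0 := ε0) (ε0 := μ0) (fun φ hφ hφs => ?_) (fun φ hφ hφs => ?_) hne
    · rw [← weakH φ hφ hφs]
      congr 1 with x
      congr 1
      module
    · have h1 := congrArg (fun z : ℂ => -z) (weakE φ hφ hφs)
      simp only [← MeasureTheory.integral_neg, ← neg_cdot] at h1
      convert h1 using 3 with x
      · rw [neg_smul]
      · rw [neg_sub, neg_sub_neg]
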